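/- **Theorem 3.2 (Geodesically convex Lyapunov functions).** Let $g$ be a $C^\infty$ Riemannian metric on $\mathbb{R}^n$ and let $U\subseteq\mathbb{R}^n$ be open and $g$-convex, that is, for all $x,y\in U$ there is a unique geodesic $\gamma:[0,1]\to\mathbb{R}^n$ of $g$ with $\gamma(0)=x$, $\gamma(1)=y$ and $\gamma([0,1])\subseteq U$. Let $F\in C^0(U;\mathbb{R}^n)$ be such that $0\in U$ is globally asymptotically stable (GAS) on $U$ under $\dot x=F(x)$, and suppose that there is a $g$-convex $C^\infty$ Lyapunov function $V:U\to\mathbb{R}_{\ge 0}$ for $F$ and $0$, that is: $V(0)=0$ and $V(x)>0$ for $x\in U\setminus\{0\}$; $\langle\nabla V(x),F(x)\rangle<0$ for $x\in U\setminus\{0\}$; $V$ is proper on $U$ (for every $c$ there is a compact $K\subseteq U$ with $V>c$ on $U\setminus K$; for $U=\mathbb{R}^n$ this means $V(x)\to\infty$ as $\|x\|\to\infty$); and $V(\gamma(t))\le(1-t)V(\gamma(0))+tV(\gamma(1))$ for every geodesic $\gamma:[0,1]\to U$ and all $t\in[0,1]$. Then for every $x\in U$ there is exactly one $v\in T_x\mathbb{R}^n\cong\mathbb{R}^n$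 such that $\mathrm{Exp}_x(tv)$ is defined and lies in $U$ for all $t\in[0,1]$ and $\mathrm{Exp}_x(v)=0$; write $\mathrm{Exp}_x^{-1}(0)$ for this $v$. The vector field $F$ is straight-line homotopic to $x\mapsto\mathrm{Exp}_x^{-1}(0)$ with $0$ GAS throughout the homotopy: the map $H:[0,1]\times U\to\mathbb{R}^n$, $$H(s,x)=(1-s)F(x)+s\,\mathrm{Exp}_x^{-1}(0),$$ is continuous, and for every $s\in[0,1]$ the point $0$ is GAS on $U$ under $\dot x=H(s,x)$. Here, for a continuous vector field $X$ on $U$, whose solutions need not be unique, $0\in U$ is GAS on $U$ under $\dot x=X(x)$ if $X(0)=0$; for every $x_0\in U$ there is a solution in $U$ on $[0,\infty)$ starting at $x_0$, and every solution in $U$ on an interval $[0,T)$ with $0<T<\infty$ extends to a solution in $U$ on $[0,\infty)$; for every open neighbourhood $W$ of $0$ there is an open neighbourhood $W'\subseteq W$ of $0$ such that every solution on $[0,\infty)$ starting in $W'$ stays in $W$; and every solution on $[0,\infty)$ converges to $0$ as $t\to\infty$. -/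

import Mathlib

open Set Filter Topology
open scoped Manifold ContDiff

namespace GeodLyap

/-- A `C^∞` Riemannian metric on `ℝⁿ`. -/
abbrev Metric (n : ℕ) : Type :=
  Bundle.ContMDiffRiemannianMetric (𝓘(ℝ, EuclideanSpace ℝ (Fin n))) ∞
    (EuclideanSpace ℝ (Fin n))
    (fun x : EuclideanSpace ℝ (Fin n) =>
      TangentSpace (𝓘(ℝ, EuclideanSpace ℝ (Fin n))) x)

variable {n : ℕ}

/-- The metric in the global coordinates of `ℝⁿ`: `coeff g x v w = ⟨v, w⟩_{g(x)}`, where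
every tangent space of `ℝⁿ` is identified with `ℝⁿ`. -/
def coeff (g : Metric n) (x : EuclideanSpace ℝ (Fin n)) :
    EuclideanSpace ℝ (Fin n) →L[ℝ] EuclideanSpace ℝ (Fin n) →L[ℝ] ℝ :=
  g.inner x

theorem coeff_contDiff (g : Metric n) : ContDiff ℝ ∞ (coeff g) := by
  rw [contDiff_clm_apply_iff]
  intro v
  rw [contDiff_clm_apply_iff]
  intro w
  rw [← contMDiff_iff_contDiff]
  have key : ∀ u : EuclideanSpace ℝ (Fin n),
      ContMDiff (𝓘(ℝ, EuclideanSpace ℝ (Fin n))) (𝓘(ℝ, EuclideanSpace ℝ (Fin n))).tangent ∞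
        (fun x : EuclideanSpace ℝ (Fin n) =>
          (⟨x, u⟩ : TangentBundle (𝓘(ℝ, EuclideanSpace ℝ (Fin n)))
            (EuclideanSpace ℝ (Fin n)))) := by
    intro u
    exact contMDiff_vectorSpace_iff_contDiff.2 contDiff_const
  have h := g.contMDiff
  have h2 := ContMDiff.clm_bundle_apply₂ (F₁ := EuclideanSpace ℝ (Fin n))
    (F₂ := EuclideanSpace ℝ (Fin n)) (F₃ := ℝ)
    (E₃ := fun _ : EuclideanSpace ℝ (Fin n) => ℝ) h (key v) (key w)
  intro x
  have h3 := h2 x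
  rw [Bundle.contMDiffAt_totalSpace] at h3
  exact h3.2

/-- The Christoffel symbols of the first kind of `g`, as a trilinear form:
`Γ(v, w; u) = ½ (D_v g(w, u) + D_w g(v, u) - D_u g(v, w))` at `x`. -/
noncomputable def christoffel (g : Metric n) (x v w u : EuclideanSpace ℝ (Fin n)) : ℝ :=
  (1 / 2 : ℝ) * (fderiv ℝ (coeff g) x v w u + fderiv ℝ (coeff g) x w v u
    - fderiv ℝ (coeff g) x u v w)

/-- `γ : [0,1] → ℝⁿ` is a geodesic of `g`: it is twice differentiable, with velocity `v` and
coordinate acceleration `a`, and satisfies the geodesic equation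
`g_{kl} γ''^l + Γ_{ij,k} γ'^i γ'^j = 0` (the Euler-Lagrange equation of the energy).
Only the values of `γ` on `[0,1]` matter. -/
def IsGeodesic (g : Metric n) (γ : ℝ → EuclideanSpace ℝ (Fin n)) : Prop :=
  ∃ v a : ℝ → EuclideanSpace ℝ (Fin n), ∀ t ∈ Icc (0 : ℝ) 1,
    HasDerivWithinAt γ (v t) (Icc 0 1) t ∧ HasDerivWithinAt v (a t) (Icc 0 1) t ∧
      ∀ u, coeff g (γ t) (a t) u + christoffel g (γ t) (v t) (v t) u = 0

/-- `γ : [0,1] → ℝⁿ` is a geodesic from `x` to `y` with `γ([0,1]) ⊆ U`. -/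
def JoinsIn (g : Metric n) (U : Set (EuclideanSpace ℝ (Fin n)))
    (x y : EuclideanSpace ℝ (Fin n)) (γ : ℝ → EuclideanSpace ℝ (Fin n)) : Prop :=
  IsGeodesic g γ ∧ MapsTo γ (Icc 0 1) U ∧ γ 0 = x ∧ γ 1 = y

/-- `U` is `g`-convex: any two points of `U` are joined by a unique geodesic
`γ : [0,1] → ℝⁿ` with `γ([0,1]) ⊆ U`. -/
def IsGConvex (g : Metric n) (U : Set (EuclideanSpace ℝ (Fin n))) : Prop :=
  ∀ x ∈ U, ∀ y ∈ U, ∃ γ, JoinsIn g U x y γ ∧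
    ∀ η, JoinsIn g U x y η → EqOn η γ (Icc 0 1)

/-- `f` is a `g`-convex function on `U`. -/
def GConvexOn (g : Metric n) (U : Set (EuclideanSpace ℝ (Fin n)))
    (f : EuclideanSpace ℝ (Fin n) → ℝ) : Prop :=
  ∀ x ∈ U, ∀ y ∈ U, ∀ γ, JoinsIn g U x y γ →
    ∀ t ∈ Icc (0 : ℝ) 1, f (γ t) ≤ (1 - t) * f x + t * f y

/-- The domain of the exponential map at `x`: the initial velocities `v` of geodesics
`γ : [0,1] → ℝⁿ` with `γ(0) = x`. -/
def expDomain (g : Metric n) (x : EuclideanSpace ℝ (Fin n)) :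
    Set (EuclideanSpace ℝ (Fin n)) :=
  {v | ∃ γ, IsGeodesic g γ ∧ γ 0 = x ∧ HasDerivWithinAt γ v (Icc 0 1) 0}

open Classical in
/-- The exponential map `Exp_x(v) = γ(1)`, with `γ` the geodesic such that `γ(0) = x` and
`γ'(0) = v`; only used for `v` in `expDomain g x`. -/
noncomputable def expMap (g : Metric n) (x v : EuclideanSpace ℝ (Fin n)) :
    EuclideanSpace ℝ (Fin n) :=
  if h : v ∈ expDomain g x then h.choose 1 else x

/-- The domain of `Exp_x` seen as exponential map of the Riemannian manifold `(U, g)`: those `v`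
for which the geodesic `[0,1] ∋ t ↦ Exp_x(t v)` stays in `U`. -/
def expDomainIn (g : Metric n) (U : Set (EuclideanSpace ℝ (Fin n)))
    (x : EuclideanSpace ℝ (Fin n)) : Set (EuclideanSpace ℝ (Fin n)) :=
  {v | v ∈ expDomain g x ∧ ∀ t ∈ Icc (0 : ℝ) 1, expMap g x (t • v) ∈ U}

/-- `ξ` is a solution in `U` of `ẋ = F(x)` on the time interval `J`. -/
def IsSolution (U : Set (EuclideanSpace ℝ (Fin n)))
    (F : EuclideanSpace ℝ (Fin n) → EuclideanSpace ℝ (Fin n)) (J : Set ℝ)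
    (ξ : ℝ → EuclideanSpace ℝ (Fin n)) : Prop :=
  ∀ t ∈ J, ξ t ∈ U ∧ HasDerivWithinAt ξ (F (ξ t)) J t

/-- `0` is globally asymptotically stable on `U` under `ẋ = F(x)`. The vector field `F` is only
continuous, so that solutions need not be unique; the conditions are imposed on all of them. -/
structure IsGAS (U : Set (EuclideanSpace ℝ (Fin n)))
    (F : EuclideanSpace ℝ (Fin n) → EuclideanSpace ℝ (Fin n)) : Prop where
  zero_mem : (0 : EuclideanSpace ℝ (Fin n)) ∈ U
  /-- `0` is an equilibrium point -/
  equilibrium : F 0 = 0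
  /-- there is a solution for all forward time from every initial state -/
  exists_solution : ∀ x ∈ U, ∃ ξ, IsSolution U F (Ici 0) ξ ∧ ξ 0 = x
  /-- no solution ceases to exist in finite forward time -/
  extends_solution : ∀ T > 0, ∀ ξ, IsSolution U F (Ico 0 T) ξ →
    ∃ ζ, IsSolution U F (Ici 0) ζ ∧ EqOn ζ ξ (Ico 0 T)
  /-- Lyapunov stability -/
  stable : ∀ W : Set (EuclideanSpace ℝ (Fin n)), IsOpen W → 0 ∈ W →
    ∃ W' : Set (EuclideanSpace ℝ (Fin n)), IsOpen W' ∧ 0 ∈ W' ∧ W' ⊆ W ∧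
      ∀ ξ, IsSolution U F (Ici 0) ξ → ξ 0 ∈ W' → ∀ t ≥ 0, ξ t ∈ W
  /-- global attractivity -/
  attractive : ∀ ξ, IsSolution U F (Ici 0) ξ → Tendsto ξ atTop (𝓝 0)

/-- `V` is a (smooth, strict and proper) Lyapunov function on `U` with respect to `F` and `0`. -/
structure IsLyapunov (U : Set (EuclideanSpace ℝ (Fin n)))
    (F : EuclideanSpace ℝ (Fin n) → EuclideanSpace ℝ (Fin n))
    (V : EuclideanSpace ℝ (Fin n) → ℝ) : Prop where
  smooth : ContDiffOn ℝ ∞ V U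
  zero : V 0 = 0
  pos : ∀ x ∈ U, x ≠ 0 → 0 < V x
  /-- `⟨∇V(x), F(x)⟩ < 0` -/
  decrease : ∀ x ∈ U, x ≠ 0 → fderiv ℝ V x (F x) < 0
  /-- `V(x) → ∞` as `x` leaves every compact subset of `U`; for `U = ℝⁿ` this says that
  `V(x) → ∞` as `‖x‖ → ∞` -/
  proper : ∀ c : ℝ, ∃ K ⊆ U, IsCompact K ∧ ∀ x ∈ U, x ∉ K → c < V x

end GeodLyap

/-! Let `γ` be the geodesic in `U` from `x` to `0`, and `X(x)` its initial velocity. Convexity gives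
`V(γ(t)) ≤ (1 - t) V(x)`; differentiating at `t = 0` yields `dV(X(x)) ≤ -V(x) < 0` for `x ≠ 0`
(`IsLyapunov.fderiv_le_of_geodesic`). So `V` is a strict Lyapunov function for `X` as well as for
`F`. The decrease condition is convex in the field, so it holds for every field of the homotopy, and
Lyapunov's direct method (`IsLyapunov.isGAS`) concludes. The fields are merely continuous, so
existence of solutions rests on Peano's theorem.

The delicate point is continuity of `X`: convexity of `U` gives existence and uniqueness of
geodesics, but no regularity of the inverse exponential. Compactness replaces it
(`IsGConvex.continuousOn_velocity`). Geodesics to `0` from points near `x` stay in one sublevel set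
of `V`, which is compact. Geodesics in a compact set have bounded velocity
(`IsGConvex.exists_velocity_bound`), so velocities subconverge; the limit is again a geodesic in `U`
from `x` to `0`, and uniqueness identifies it.

The velocity bound is a pigeonhole argument: a geodesic that is too fast visits one small
neighbourhood twice within a short parameter interval, and the piece in between would compete with
the short geodesic from `exists_short_geodesics`. -/

namespace GeodLyap

/-! ### Peano existence by Euler polygons -/

section Peano

variable {E : Type*} [NormedAddCommGroup E] [NormedSpace ℝ E]

/-- The explicit Euler scheme with step size `h`. -/
def euler (G : E → E) (x : E) (h : ℝ) : ℕ → E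
  | 0 => x
  | j + 1 => euler G x h j + h • G (euler G x h j)

/-- The Euler increment is a sum of steps `h • G`, each within `h * ε` of `h • w`. With `w = 0` this
bounds displacement; with `w = G (ξ t)` it becomes the differentiability estimate in the limit. -/
theorem norm_euler_sub_le (G : E → E) (x w : E) {h ε : ℝ} (hh : 0 ≤ h) {i j : ℕ} (hij : i ≤ j)
    (H : ∀ l, i ≤ l → l < j → ‖G (euler G x h l) - w‖ ≤ ε) :
    ‖euler G x h j - euler G x h i - (((j : ℝ) - i) * h) • w‖ ≤ ((j : ℝ) - i) * h * ε := by
  induction j, hij using Nat.le_induction with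
  | base => simp
  | succ j hij ih =>
    have h1 := ih fun l hl hl' => H l hl (hl'.trans j.lt_succ_self)
    have h2 := H j hij j.lt_succ_self
    have e : euler G x h (j + 1) - euler G x h i - ((((j + 1 : ℕ) : ℝ) - i) * h) • w
        = (euler G x h j - euler G x h i - (((j : ℝ) - i) * h) • w)
          + h • (G (euler G x h j) - w) := by
      rw [euler]; push_cast; module
    rw [e]
    calc _ ≤ ((j : ℝ) - i) * h * ε + h * ε := by
          refine (norm_add_le _ _).trans (add_le_add h1 ?_)
          rw [norm_smul, Real.norm_of_nonneg hh]
          gcongr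
      _ = _ := by push_cast; ring

theorem norm_euler_sub_le_of_bounded {G : E → E} {x : E} {h M : ℝ} (hh : 0 ≤ h)
    (hM : ∀ y, ‖G y‖ ≤ M) {i j m m' : ℕ} (hi : i ∈ Icc m m') (hj : j ∈ Icc m m') :
    ‖euler G x h j - euler G x h i‖ ≤ ((m' : ℝ) - m) * h * M := by
  have hM0 : 0 ≤ M := (norm_nonneg _).trans (hM x)
  have key : ∀ {i j : ℕ}, i ∈ Icc m m' → j ∈ Icc m m' → i ≤ j →
      ‖euler G x h j - euler G x h i‖ ≤ ((m' : ℝ) - m) * h * M := by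
    intro i j hi hj hij
    have := norm_euler_sub_le G x 0 hh hij (ε := M) (fun l _ _ => by simpa using hM _)
    rw [smul_zero, sub_zero] at this
    refine this.trans ?_
    have h1 : (j : ℝ) ≤ m' := by exact_mod_cast hj.2
    have h2 : (m : ℝ) ≤ i := by exact_mod_cast hi.1
    gcongr
  rcases le_total i j with hij | hij
  · exact key hi hj hij
  · rw [norm_sub_rev]; exact key hj hi hij

theorem tendsto_floor_mul_inv {a : ℝ} (ha : 0 ≤ a) :
    Tendsto (fun k : ℕ => (⌊a * k⌋₊ : ℝ) * (k : ℝ)⁻¹) atTop (𝓝 a) := by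
  simpa [div_eq_mul_inv, Function.comp_def] using
    (tendsto_nat_floor_mul_div_atTop ha).comp tendsto_natCast_atTop_atTop

/-- **Peano's theorem** for bounded continuous vector fields: there is a solution for all forward
time. -/
theorem exists_hasDerivWithinAt_Ici [ProperSpace E] {G : E → E} (hG : Continuous G) {M : ℝ}
    (hM : ∀ y, ‖G y‖ ≤ M) (x : E) :
    ∃ ξ : ℝ → E, ξ 0 = x ∧ ∀ t ≥ 0, HasDerivWithinAt ξ (G (ξ t)) (Ici 0) t := by
  have hM0 : 0 ≤ M := (norm_nonneg _).trans (hM x)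
  set f : ℕ → ℝ → E := fun k t => euler G x (k : ℝ)⁻¹ ⌊t * k⌋₊ with hf
  have hinv : ∀ k : ℕ, (0 : ℝ) ≤ (k : ℝ)⁻¹ := fun k => by positivity
  have hflo : ∀ (k : ℕ) (t : ℝ), 0 ≤ t → (⌊t * k⌋₊ : ℝ) * (k : ℝ)⁻¹ ≤ t := by
    intro k t ht
    rcases Nat.eq_zero_or_pos k with rfl | hk
    · simpa
    · rw [← div_eq_mul_inv, div_le_iff₀ (by exact_mod_cast hk)]
      exact Nat.floor_le (by positivity)
  -- A limit along an ultrafilter exists at every time simultaneously, by compactness of a ball; no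
  -- diagonal subsequence or Arzelà–Ascoli is needed.
  have hlim : ∀ t, ∃ y, 0 ≤ t → Tendsto (fun k => f k t) (hyperfilter ℕ) (𝓝 y) := by
    intro t
    by_cases ht : 0 ≤ t
    swap
    · exact ⟨x, fun h => absurd h ht⟩
    have hb : ∀ k, f k t ∈ Metric.closedBall x (t * M) := by
      intro k
      have := norm_euler_sub_le_of_bounded (x := x) (hinv k) hM
        (i := 0) (j := ⌊t * k⌋₊) (m := 0) (m' := ⌊t * k⌋₊) (by simp) (by simp)
      rw [mem_closedBall_iff_norm]
      refine this.trans ?_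
      have := hflo k t ht
      simp only [Nat.cast_zero, sub_zero]
      gcongr
    obtain ⟨y, -, hy⟩ := (isCompact_closedBall x (t * M)).ultrafilter_le_nhds
      ((hyperfilter ℕ).map fun k => f k t)
      (le_principal_iff.2 (Eventually.of_forall (f := (hyperfilter ℕ : Filter ℕ)) hb))
    exact ⟨y, fun _ => hy⟩
  choose ξ hξ using hlim
  have hat : (hyperfilter ℕ : Filter ℕ) ≤ atTop := by
    rw [← Nat.cofinite_eq_atTop]; exact hyperfilter_le_cofinite
  -- Letting `t` lie anywhere in `[a, b]` covers the left and the right difference quotients at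
  -- once.
  have key : ∀ t ≥ 0, ∀ ε > 0, ∃ η > 0, ∀ a b, 0 ≤ a → a ≤ b → t ∈ Icc a b → b - a ≤ η →
      ‖ξ b - ξ a - (b - a) • G (ξ t)‖ ≤ (b - a) * ε := by
    intro t ht ε hε
    obtain ⟨δ, hδ, hδ'⟩ := Metric.continuousAt_iff.1 (hG.continuousAt (x := ξ t)) ε hε
    -- This size forces `(b - a) * M < δ / 2`, so Euler points with times in `[a, b]` stay `δ`-close
    -- to `ξ t`; the `+ 1` allows `M = 0`.
    refine ⟨δ / (4 * (M + 1)), by positivity, fun a b ha hab htab hη => ?_⟩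
    have hb := ha.trans hab
    have hfl : Tendsto (fun k : ℕ => ((⌊b * k⌋₊ : ℝ) - ⌊a * k⌋₊) * (k : ℝ)⁻¹) (hyperfilter ℕ)
        (𝓝 (b - a)) := by
      simpa [sub_mul] using ((tendsto_floor_mul_inv hb).sub (tendsto_floor_mul_inv ha)).mono_left hat
    have hbound : (b - a) * M < δ / 2 := by
      calc (b - a) * M ≤ δ / (4 * (M + 1)) * M := by gcongr
        _ < δ / 2 := by
          rw [div_mul_eq_mul_div, div_lt_div_iff₀ (by positivity) (by positivity)]
          nlinarith
    have ev1 := (hfl.mul_const M).eventually_lt_const hbound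
    have ev2 := (hξ t ht).eventually (Metric.ball_mem_nhds _ (half_pos hδ))
    refine le_of_tendsto_of_tendsto
      (((hξ b hb).sub (hξ a ha)).sub (hfl.smul_const (G (ξ t)))).norm (hfl.mul_const ε) ?_
    filter_upwards [ev1, ev2] with k h1 h2
    have hm : ∀ {s s' : ℝ}, s ≤ s' → ⌊s * k⌋₊ ≤ ⌊s' * k⌋₊ := fun h => by gcongr
    refine norm_euler_sub_le G x _ (hinv k) (hm hab) fun l hl hl' => ?_
    have h3 := norm_euler_sub_le_of_bounded (x := x) (hinv k) hM
      (i := ⌊t * k⌋₊) (j := l) (m := ⌊a * k⌋₊) (m' := ⌊b * k⌋₊)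
      ⟨hm htab.1, hm htab.2⟩ ⟨hl, hl'.le⟩
    rw [← dist_eq_norm] at h3 ⊢
    refine (hδ' ?_).le
    calc _ ≤ _ := dist_triangle _ (f k t) _
      _ < δ / 2 + δ / 2 := add_lt_add (h3.trans_lt h1) h2
      _ = δ := by ring
  refine ⟨ξ, ?_, fun t ht => ?_⟩
  · refine tendsto_nhds_unique (hξ 0 le_rfl) ?_
    simp [hf, euler]
  · rw [hasDerivWithinAt_iff_isLittleO, Asymptotics.isLittleO_iff]
    intro ε hε
    obtain ⟨η, hη, H⟩ := key t ht ε hε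
    filter_upwards [self_mem_nhdsWithin, mem_nhdsWithin_of_mem_nhds (Metric.ball_mem_nhds t hη)]
      with s hs hst
    rw [Metric.mem_ball, Real.dist_eq] at hst
    have hst' := abs_lt.1 hst
    rcases le_total s t with h | h
    · have := H s t hs h ⟨h, le_rfl⟩ (by linarith)
      rw [Real.norm_eq_abs, abs_of_nonpos (by linarith)]
      rw [show ξ s - ξ t - (s - t) • G (ξ t) = -(ξ t - ξ s - (t - s) • G (ξ t)) by module,
        norm_neg]
      linarith
    · have := H t s ht h ⟨le_rfl, h⟩ (by linarith)
      rw [Real.norm_eq_abs, abs_of_nonneg (by linarith)]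
      linarith

end Peano

/-! ### Lyapunov's direct method -/

section Lyapunov

variable {n : ℕ} {U : Set (EuclideanSpace ℝ (Fin n))}
  {G : EuclideanSpace ℝ (Fin n) → EuclideanSpace ℝ (Fin n)}
  {V : EuclideanSpace ℝ (Fin n) → ℝ}

theorem IsLyapunov.differentiableAt (hV : IsLyapunov U G V) (hU : IsOpen U)
    {x : EuclideanSpace ℝ (Fin n)} (hx : x ∈ U) : DifferentiableAt ℝ V x :=
  (hV.smooth.differentiableOn (by simp)).differentiableAt (hU.mem_nhds hx)

theorem IsLyapunov.nonneg (hV : IsLyapunov U G V) {x : EuclideanSpace ℝ (Fin n)} (hx : x ∈ U) :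
    0 ≤ V x := by
  by_cases h : x = 0
  · rw [h, hV.zero]
  · exact (hV.pos x hx h).le

theorem IsLyapunov.fderiv_nonpos (hV : IsLyapunov U G V) (hG0 : G 0 = 0)
    {x : EuclideanSpace ℝ (Fin n)} (hx : x ∈ U) : fderiv ℝ V x (G x) ≤ 0 := by
  by_cases h : x = 0
  · rw [h, hG0, map_zero]
  · exact (hV.decrease x hx h).le

theorem IsLyapunov.isCompact_inter_preimage (hV : IsLyapunov U G V) {C : Set ℝ}
    (hC : IsClosed C) {c : ℝ} (hc : ∀ r ∈ C, r ≤ c) : IsCompact (U ∩ V ⁻¹' C) := by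
  obtain ⟨K, hKU, hK, hKV⟩ := hV.proper c
  have : U ∩ V ⁻¹' C = K ∩ V ⁻¹' C := by
    ext x
    refine ⟨fun ⟨hx, hxC⟩ => ⟨?_, hxC⟩, fun ⟨hx, hxC⟩ => ⟨hKU hx, hxC⟩⟩
    by_contra h
    exact absurd (hKV x hx h) (not_lt.2 (hc _ hxC))
  rw [this]
  exact hK.of_isClosed_subset
    ((hV.smooth.continuousOn.mono hKU).preimage_isClosed_of_isClosed hK.isClosed hC)
    inter_subset_left

theorem IsLyapunov.isCompact_sublevel (hV : IsLyapunov U G V) (c : ℝ) :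
    IsCompact (U ∩ V ⁻¹' Iic c) :=
  hV.isCompact_inter_preimage isClosed_Iic fun _ h => h

/-- Sublevel sets of a Lyapunov function form a neighbourhood basis of the equilibrium. -/
theorem IsLyapunov.exists_sublevel_subset (hV : IsLyapunov U G V)
    {W : Set (EuclideanSpace ℝ (Fin n))} (hW : IsOpen W) (h0 : 0 ∈ W) :
    ∃ m > 0, ∀ x ∈ U, V x < m → x ∈ W := by
  have hS : IsCompact ((U ∩ V ⁻¹' Iic 1) \ W) := (hV.isCompact_sublevel 1).diff hW
  rcases ((U ∩ V ⁻¹' Iic 1) \ W).eq_empty_or_nonempty with he | hne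
  · refine ⟨1, one_pos, fun x hx hxV => ?_⟩
    by_contra hxW
    exact (he ▸ (⟨⟨hx, hxV.le⟩, hxW⟩ : x ∈ (U ∩ V ⁻¹' Iic 1) \ W) : x ∈ (∅ : Set _))
  · obtain ⟨y, hy, hmin⟩ := hS.exists_isMinOn hne
      (hV.smooth.continuousOn.mono fun x hx => hx.1.1)
    refine ⟨min 1 (V y), lt_min one_pos (hV.pos y hy.1.1 ?_), fun x hx hxV => ?_⟩
    · rintro rfl; exact hy.2 h0
    · by_contra hxW
      have h1 := isMinOn_iff.1 hmin x ⟨⟨hx, (hxV.trans_le (min_le_left _ _)).le⟩, hxW⟩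
      exact absurd h1 (not_le.2 (hxV.trans_le (min_le_right _ _)))

theorem IsLyapunov.hasDerivWithinAt_comp (hV : IsLyapunov U G V) (hU : IsOpen U)
    {ξ : ℝ → EuclideanSpace ℝ (Fin n)} {w : EuclideanSpace ℝ (Fin n)} {J : Set ℝ} {t : ℝ}
    (ht : ξ t ∈ U) (h : HasDerivWithinAt ξ w J t) :
    HasDerivWithinAt (V ∘ ξ) (fderiv ℝ V (ξ t) w) J t :=
  (hV.differentiableAt hU ht).hasFDerivAt.comp_hasDerivWithinAt t h

theorem IsLyapunov.image_sub_le (hV : IsLyapunov U G V) (hU : IsOpen U)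
    {ξ ξ' : ℝ → EuclideanSpace ℝ (Fin n)} {J : Set ℝ} (hJ : Convex ℝ J) {C : ℝ}
    (hξU : ∀ t ∈ J, ξ t ∈ U) (hξ : ∀ t ∈ J, HasDerivWithinAt ξ (ξ' t) J t)
    (hC : ∀ t ∈ J, fderiv ℝ V (ξ t) (ξ' t) ≤ C) {s t : ℝ} (hs : s ∈ J) (ht : t ∈ J)
    (hst : s ≤ t) : V (ξ t) - V (ξ s) ≤ C * (t - s) := by
  have h1 : ∀ t ∈ J, HasDerivWithinAt (V ∘ ξ) (fderiv ℝ V (ξ t) (ξ' t)) J t := fun t ht =>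
    hV.hasDerivWithinAt_comp hU (hξU t ht) (hξ t ht)
  have h2 : ∀ t ∈ interior J, HasDerivAt (V ∘ ξ) (fderiv ℝ V (ξ t) (ξ' t)) t := fun t ht =>
    (h1 t (interior_subset ht)).hasDerivAt (mem_interior_iff_mem_nhds.1 ht)
  refine hJ.image_sub_le_mul_sub_of_deriv_le (f := V ∘ ξ)
    (fun t ht => (h1 t ht).continuousWithinAt)
    (fun t ht => (h2 t ht).differentiableAt.differentiableWithinAt) (fun t ht => ?_) s hs t ht hst
  rw [(h2 t ht).deriv]
  exact hC t (interior_subset ht)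

theorem IsLyapunov.antitoneOn (hV : IsLyapunov U G V) (hU : IsOpen U) (hG0 : G 0 = 0)
    {ξ : ℝ → EuclideanSpace ℝ (Fin n)} {J : Set ℝ} (hJ : Convex ℝ J)
    (hξ : IsSolution U G J ξ) : AntitoneOn (V ∘ ξ) J := fun s hs t ht hst => by
  have := hV.image_sub_le hU hJ (C := 0) (fun t ht => (hξ t ht).1) (fun t ht => (hξ t ht).2)
    (fun t ht => hV.fderiv_nonpos hG0 (hξ t ht).1) hs ht hst
  simpa using this

/-- Multiplying `G` by a cutoff `χ` with compact support in `U` gives a bounded continuous field on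
the whole space. Since `χ ≥ 0`, `V` still does not increase, so the sublevel set of `x` is
invariant; there `χ = 1` and the solution solves the original equation. -/
theorem IsLyapunov.exists_solution (hV : IsLyapunov U G V) (hU : IsOpen U)
    (hG : ContinuousOn G U) (hG0 : G 0 = 0) {x : EuclideanSpace ℝ (Fin n)} (hx : x ∈ U) :
    ∃ ξ, IsSolution U G (Ici 0) ξ ∧ ξ 0 = x := by
  set K := U ∩ V ⁻¹' Iic (V x) with hKdef
  have hK : IsCompact K := hV.isCompact_sublevel _
  obtain ⟨K', hK', hKK', hK'U⟩ := exists_compact_between hK hU inter_subset_left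
  obtain ⟨χ, hχ1, hχ0, -, hχ⟩ := exists_continuous_one_zero_of_isCompact hK
    isOpen_interior.isClosed_compl (disjoint_compl_right_iff_subset.2 hKK')
  have hsupp : ∀ y ∉ K', χ y • G y = 0 := fun y hy => by
    rw [hχ0 (fun h => hy (interior_subset h))]; simp
  have hcont : Continuous fun y => χ y • G y := by
    rw [continuous_iff_continuousAt]
    intro y
    by_cases hy : y ∈ U
    · exact χ.continuous.continuousAt.smul (hG.continuousAt (hU.mem_nhds hy))
    · have : (fun y => χ y • G y) =ᶠ[𝓝 y] fun _ => 0 := by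
        filter_upwards [hK'.isClosed.isOpen_compl.mem_nhds fun h => hy (hK'U h)] with z hz
        exact hsupp z hz
      exact continuousAt_const.congr this.symm
  obtain ⟨M, hM⟩ := hcont.bounded_above_of_compact_support (HasCompactSupport.intro hK' hsupp)
  obtain ⟨ξ, hξ0, hξ⟩ := exists_hasDerivWithinAt_Ici hcont hM x
  have hξc : ContinuousOn ξ (Ici 0) := fun t ht => (hξ t ht).continuousWithinAt
  have hmem : ∀ t ≥ 0, ξ t ∈ K := by
    intro t ht
    -- Continuous induction: the good times form a closed set, and from a good time the solution
    -- stays in the open set `U` for a while, where `V` cannot increase.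
    have hsub : Icc 0 t ⊆ ξ ⁻¹' K := by
      refine IsClosed.Icc_subset_of_forall_mem_nhdsWithin ?_ ?_ ?_
      · rw [inter_comm]
        exact (hξc.mono Icc_subset_Ici_self).preimage_isClosed_of_isClosed isClosed_Icc
          hK.isClosed
      · simp [hξ0, hKdef, hx]
      · rintro s ⟨hs, hst⟩
        have h1 : ∀ᶠ r in 𝓝[≥] s, ξ r ∈ U :=
          ((hξc s hst.1).mono (Ici_subset_Ici.2 hst.1)).eventually (hU.mem_nhds hs.1)
        obtain ⟨u, hu, hsu⟩ := (mem_nhdsGE_iff_exists_Ico_subset' (lt_add_one s)).1 h1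
        filter_upwards [Ioo_mem_nhdsGT hu] with r hr
        refine ⟨hsu ⟨hr.1.le, hr.2⟩, ?_⟩
        have hmono := hV.image_sub_le hU (convex_Ico s u) (C := 0) (ξ := ξ)
          (ξ' := fun t => χ (ξ t) • G (ξ t))
          (fun t ht => hsu ht)
          (fun t ht => (hξ t (hst.1.trans ht.1)).mono fun t' ht' => hst.1.trans ht'.1)
          (fun t ht => by
            simp only [map_smul, smul_eq_mul]
            exact mul_nonpos_of_nonneg_of_nonpos (hχ _).1 (hV.fderiv_nonpos hG0 (hsu ht)))
          ⟨le_rfl, hr.1.trans hr.2⟩ ⟨hr.1.le, hr.2⟩ hr.1.le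
        have h2 : V (ξ s) ≤ V x := hs.2
        show V (ξ r) ≤ V x
        linarith
    exact hsub ⟨ht, le_rfl⟩
  refine ⟨ξ, fun t ht => ⟨(hmem t ht).1, ?_⟩, hξ0⟩
  have := hξ t ht
  rwa [hχ1 (hmem t ht), Pi.one_apply, one_smul] at this

/-- The solution stays in a compact sublevel set, hence has bounded speed and a limit at `T` inside
`U`. A new solution started at that limit is glued on. -/
theorem IsLyapunov.extends_solution (hV : IsLyapunov U G V) (hU : IsOpen U)
    (hG : ContinuousOn G U) (hG0 : G 0 = 0) {T : ℝ} (hT : 0 < T)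
    {ξ : ℝ → EuclideanSpace ℝ (Fin n)} (hξ : IsSolution U G (Ico 0 T) ξ) :
    ∃ ζ, IsSolution U G (Ici 0) ζ ∧ EqOn ζ ξ (Ico 0 T) := by
  set K := U ∩ V ⁻¹' Iic (V (ξ 0)) with hKdef
  have hK : IsCompact K := hV.isCompact_sublevel _
  have hmem : ∀ t ∈ Ico 0 T, ξ t ∈ K := fun t ht => ⟨(hξ t ht).1,
    hV.antitoneOn hU hG0 (convex_Ico 0 T) hξ ⟨le_rfl, hT⟩ ht ht.1⟩
  obtain ⟨M, hM⟩ := hK.exists_bound_of_continuousOn (hG.mono inter_subset_left)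
  have hlip : LipschitzOnWith M.toNNReal ξ (Ico 0 T) :=
    (convex_Ico 0 T).lipschitzOnWith_of_nnnorm_hasDerivWithin_le (fun t ht => (hξ t ht).2)
      fun t ht => by
        rw [← NNReal.coe_le_coe, coe_nnnorm]
        exact (hM _ (hmem t ht)).trans (Real.le_coe_toNNReal M)
  -- The value at `T` of a Lipschitz extension serves as the left limit.
  obtain ⟨ξ', hξ', heq⟩ := hlip.extend_finite_dimension
  have hlim : Tendsto ξ' (𝓝[<] T) (𝓝 (ξ' T)) := hξ'.continuous.continuousAt.mono_left inf_le_left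
  have hIco : Ioo 0 T ∈ 𝓝[<] T := Ioo_mem_nhdsLT hT
  have hTK : ξ' T ∈ K := by
    refine hK.isClosed.mem_of_tendsto hlim ?_
    filter_upwards [hIco] with t ht
    rw [← heq ⟨ht.1.le, ht.2⟩]
    exact hmem t ⟨ht.1.le, ht.2⟩
  obtain ⟨η, hη, hη0⟩ := hV.exists_solution hU hG hG0 hTK.1
  set ζ : ℝ → EuclideanSpace ℝ (Fin n) := fun t => if t < T then ξ t else η (t - T) with hζ
  have hζ1 : EqOn ζ ξ (Ico 0 T) := fun t ht => if_pos ht.2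
  have hζ2 : EqOn ζ (fun t => η (t - T)) (Ici T) := fun t ht => if_neg (not_lt.2 ht)
  have hζT : ζ T = ξ' T := by rw [hζ2 self_mem_Ici]; simp [hη0]
  have hleft : ∀ t ∈ Ico 0 T, HasDerivWithinAt ζ (G (ζ t)) (Ici 0) t := fun t ht => by
    rw [hζ1 ht]
    refine ((hξ t ht).2.congr hζ1 (hζ1 ht)).mono_of_mem_nhdsWithin ?_
    exact mem_nhdsWithin.2 ⟨Iio T, isOpen_Iio, ht.2, fun s hs => ⟨hs.2, hs.1⟩⟩
  have hright : ∀ t ∈ Ici T, HasDerivWithinAt ζ (G (ζ t)) (Ici T) t := fun t ht => by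
    rw [hζ2 ht]
    refine HasDerivWithinAt.congr ?_ hζ2 (hζ2 ht)
    have h1 := (hη (t - T) (mem_Ici.2 (sub_nonneg.2 ht))).2
    have h2 : HasDerivWithinAt (fun s : ℝ => s - T) 1 (Ici T) t :=
      ((hasDerivAt_id t).sub_const T).hasDerivWithinAt
    simpa [Function.comp_def] using h1.scomp t h2 fun s hs => sub_nonneg.2 hs
  have hatT : HasDerivAt ζ (G (ζ T)) T := by
    have hl : HasDerivWithinAt ζ (G (ζ T)) (Iic T) T := by
      have hd : ∀ t ∈ Ioo 0 T, HasDerivAt ζ (G (ζ t)) t := fun t ht =>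
        (hleft t ⟨ht.1.le, ht.2⟩).hasDerivAt (Ici_mem_nhds ht.1)
      have hcont : Tendsto ζ (𝓝[<] T) (𝓝 (ζ T)) := by
        rw [hζT]
        refine hlim.congr' ?_
        filter_upwards [hIco] with t ht
        rw [hζ1 ⟨ht.1.le, ht.2⟩, heq ⟨ht.1.le, ht.2⟩]
      -- At the gluing time the left derivative is the limit of the derivatives, which is `G (ζ T)`
      -- by continuity of `G`.
      refine hasDerivWithinAt_Iic_of_tendsto_deriv (s := Ioo 0 T)
        (fun t ht => (hd t ht).differentiableAt.differentiableWithinAt)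
        (hcont.mono_left (nhdsWithin_mono _ fun t ht => ht.2)) hIco ?_
      have h3 : Tendsto (fun t => G (ζ t)) (𝓝[<] T) (𝓝 (G (ζ T))) :=
        ((hG.continuousAt (hU.mem_nhds (hζT ▸ hTK.1))).tendsto).comp hcont
      refine h3.congr' ?_
      filter_upwards [hIco] with t ht
      rw [(hd t ht).deriv]
    have := hl.union (hright T self_mem_Ici)
    rwa [Iic_union_Ici, hasDerivWithinAt_univ] at this
  refine ⟨ζ, fun t ht => ?_, hζ1⟩
  rcases lt_trichotomy t T with h | rfl | h
  · exact ⟨hζ1 ⟨ht, h⟩ ▸ (hξ t ⟨ht, h⟩).1, hleft t ⟨ht, h⟩⟩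
  · exact ⟨hζT ▸ hTK.1, hatT.hasDerivWithinAt⟩
  · refine ⟨hζ2 h.le ▸ (hη (t - T) (sub_nonneg.2 h.le)).1, ?_⟩
    exact ((hright t h.le).hasDerivAt (Ici_mem_nhds h)).hasDerivWithinAt

/-- Otherwise the solution remains in the compact shell `ε ≤ V ≤ V (ξ 0)`, where `dV(G)` has a
negative maximum `a`. Then `V` decreases at least linearly and is at most `0` at time `V (ξ 0) /
(-a)`. -/
theorem IsLyapunov.exists_lt (hV : IsLyapunov U G V) (hU : IsOpen U) (hG : ContinuousOn G U)
    (hG0 : G 0 = 0) {ξ : ℝ → EuclideanSpace ℝ (Fin n)} (hξ : IsSolution U G (Ici 0) ξ)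
    {ε : ℝ} (hε : 0 < ε) : ∃ t ≥ 0, V (ξ t) < ε := by
  by_contra! hcon
  have hanti := hV.antitoneOn hU hG0 (convex_Ici 0) hξ
  set S := U ∩ V ⁻¹' Icc ε (V (ξ 0)) with hSdef
  have hS : IsCompact S := hV.isCompact_inter_preimage isClosed_Icc fun _ h => h.2
  have hmem : ∀ t ∈ Ici (0 : ℝ), ξ t ∈ S := fun t ht =>
    ⟨(hξ t ht).1, hcon t ht, hanti self_mem_Ici ht ht⟩
  have hfc : ContinuousOn (fun x => fderiv ℝ V x (G x)) S :=
    ((hV.smooth.continuousOn_fderiv_of_isOpen hU (by simp)).clm_apply hG).mono inter_subset_left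
  obtain ⟨y, hy, hmax⟩ := hS.exists_isMaxOn ⟨ξ 0, hmem 0 self_mem_Ici⟩ hfc
  have hneg : fderiv ℝ V y (G y) < 0 := hV.decrease y hy.1 <| by
    rintro rfl
    have := hy.2.1
    rw [hV.zero] at this
    exact absurd this (not_le.2 hε)
  set a := fderiv ℝ V y (G y)
  have hbound : ∀ t ≥ 0, V (ξ t) - V (ξ 0) ≤ a * (t - 0) := fun t ht =>
    hV.image_sub_le hU (convex_Ici 0) (fun t ht => (hξ t ht).1) (fun t ht => (hξ t ht).2)
      (fun t ht => isMaxOn_iff.1 hmax _ (hmem t ht)) self_mem_Ici ht ht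
  have h0 := hV.nonneg (hξ 0 self_mem_Ici).1
  have ht : 0 ≤ V (ξ 0) / (-a) := div_nonneg h0 (by linarith)
  have h1 := hbound _ ht
  have h2 := hcon _ ht
  have h3 : a * (V (ξ 0) / (-a) - 0) = - V (ξ 0) := by
    rw [sub_zero, mul_div_assoc', div_eq_iff (by linarith)]; ring
  linarith

/-- **Lyapunov's direct method** for continuous vector fields. -/
theorem IsLyapunov.isGAS (hV : IsLyapunov U G V) (hU : IsOpen U) (h0 : 0 ∈ U)
    (hG : ContinuousOn G U) (hG0 : G 0 = 0) : IsGAS U G where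
  zero_mem := h0
  equilibrium := hG0
  exists_solution x hx := hV.exists_solution hU hG hG0 hx
  extends_solution T hT ξ hξ := hV.extends_solution hU hG hG0 hT hξ
  stable W hW hW0 := by
    obtain ⟨m, hm, hmW⟩ := hV.exists_sublevel_subset hW hW0
    refine ⟨U ∩ V ⁻¹' Iio m, hV.smooth.continuousOn.isOpen_inter_preimage hU isOpen_Iio,
      ⟨h0, by simpa [hV.zero] using hm⟩, fun x hx => hmW x hx.1 hx.2, fun ξ hξ hξ0 t ht => ?_⟩
    exact hmW _ (hξ t ht).1
      ((hV.antitoneOn hU hG0 (convex_Ici 0) hξ self_mem_Ici ht ht).trans_lt hξ0.2)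
  attractive ξ hξ := by
    rw [(nhds_basis_opens (0 : EuclideanSpace ℝ (Fin n))).tendsto_right_iff]
    rintro W ⟨hW0, hW⟩
    obtain ⟨m, hm, hmW⟩ := hV.exists_sublevel_subset hW hW0
    obtain ⟨s, hs, hsm⟩ := hV.exists_lt hU hG hG0 hξ hm
    filter_upwards [eventually_ge_atTop s] with t ht
    exact hmW _ (hξ t (hs.le.trans ht)).1
      ((hV.antitoneOn hU hG0 (convex_Ici 0) hξ hs (hs.le.trans ht) ht).trans_lt hsm)

end Lyapunov

/-! ### Truncated flows of `C¹` vector fields -/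

theorem hasDerivWithinAt_Ici_of_Icc {E : Type*} [NormedAddCommGroup E] [NormedSpace ℝ E]
    {z : ℝ → E} {z' : E} {t : ℝ} (ht : t ∈ Ico (0 : ℝ) 1)
    (h : HasDerivWithinAt z z' (Icc 0 1) t) : HasDerivWithinAt z z' (Ici t) t :=
  (h.mono (Icc_subset_Icc_left ht.1)).mono_of_mem_nhdsWithin (Icc_mem_nhdsGE ht.2)

section Flow

variable {P : Type*} [NormedAddCommGroup P] [NormedSpace ℝ P] [FiniteDimensional ℝ P]

/-- A `C¹` vector field agrees on a given ball with a bounded Lipschitz vector field. -/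
theorem exists_lipschitzWith_eqOn_closedBall {Y : P → P} (hY : ContDiff ℝ 1 Y) (R : ℝ) :
    ∃ (Z : P → P) (L : NNReal) (M : ℝ), LipschitzWith L Z ∧ (∀ y, ‖Z y‖ ≤ M) ∧
      EqOn Z Y (Metric.closedBall 0 R) := by
  -- Bump radii must be positive, whatever the sign of `R`.
  have hr : (0 : ℝ) < |R| + 1 := by positivity
  let χ : ContDiffBump (0 : P) := ⟨|R| + 1, |R| + 2, hr, by linarith⟩
  have hZ : ContDiff ℝ 1 fun y => χ y • Y y := χ.contDiff.smul hY
  have hs : HasCompactSupport fun y => χ y • Y y := χ.hasCompactSupport.smul_right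
  obtain ⟨L, hL⟩ := hZ.lipschitzWith_of_hasCompactSupport hs one_ne_zero
  obtain ⟨M, hM⟩ := hZ.continuous.bounded_above_of_compact_support hs
  refine ⟨_, L, M, hL, hM, fun y hy => ?_⟩
  have : χ y = 1 := χ.one_of_mem_closedBall
    (Metric.closedBall_subset_closedBall ((le_abs_self R).trans (by simp [χ])) hy)
  simp [this]

/-- The time-one flow of a `C¹` vector field, for trajectories that stay in a given ball. -/
theorem exists_flow {Y : P → P} (hY : ContDiff ℝ 1 Y) (R : ℝ) :
    ∃ (Φ : P → ℝ → P) (L : ℝ), 0 < L ∧ (∀ z, Φ z 0 = z) ∧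
      (∀ z, ∀ t ∈ Icc (0 : ℝ) 1, Φ z t ∈ Metric.closedBall 0 R →
        HasDerivWithinAt (Φ z) (Y (Φ z t)) (Icc 0 1) t) ∧
      (∀ z w, ∀ t ∈ Icc (0 : ℝ) 1, ‖Φ z t - Φ w t‖ ≤ L * ‖z - w‖) ∧
      ∀ ζ : ℝ → P, (∀ t ∈ Icc (0 : ℝ) 1, HasDerivWithinAt ζ (Y (ζ t)) (Icc 0 1) t) →
        (∀ t ∈ Icc (0 : ℝ) 1, ζ t ∈ Metric.closedBall 0 R) → EqOn ζ (Φ (ζ 0)) (Icc 0 1) := by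
  obtain ⟨Z, L, M, hL, hM, heq⟩ := exists_lipschitzWith_eqOn_closedBall hY R
  have := FiniteDimensional.proper_real P
  choose Φ hΦ0 hΦ using fun z => exists_hasDerivWithinAt_Ici hL.continuous hM z
  have hd : ∀ z, ∀ t ∈ Icc (0 : ℝ) 1, HasDerivWithinAt (Φ z) (Z (Φ z t)) (Icc 0 1) t :=
    fun z t ht => (hΦ z t ht.1).mono Icc_subset_Ici_self
  -- Grönwall for the truncated field gives both the Lipschitz dependence on initial data and the
  -- uniqueness clause.
  have hdist : ∀ f g : ℝ → P,
      (∀ t ∈ Icc (0 : ℝ) 1, HasDerivWithinAt f (Z (f t)) (Icc 0 1) t) →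
      (∀ t ∈ Icc (0 : ℝ) 1, HasDerivWithinAt g (Z (g t)) (Icc 0 1) t) →
      ∀ t ∈ Icc (0 : ℝ) 1, ‖f t - g t‖ ≤ Real.exp L * ‖f 0 - g 0‖ := by
    intro f g hf hg t ht
    have h := dist_le_of_trajectories_ODE (v := fun _ => Z) (K := L) (fun _ => hL)
      (fun t ht => (hf t ht).continuousWithinAt)
      (fun t ht => hasDerivWithinAt_Ici_of_Icc ht (hf t ⟨ht.1, ht.2.le⟩))
      (fun t ht => (hg t ht).continuousWithinAt)
      (fun t ht => hasDerivWithinAt_Ici_of_Icc ht (hg t ⟨ht.1, ht.2.le⟩)) le_rfl t ht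
    rw [dist_eq_norm, dist_eq_norm, mul_comm] at h
    refine h.trans ?_
    gcongr
    have := L.coe_nonneg
    nlinarith [ht.1, ht.2]
  refine ⟨Φ, Real.exp L, Real.exp_pos _, hΦ0, fun z t ht hz => ?_, fun z w t ht => ?_,
    fun ζ hζ hζR t ht => ?_⟩
  · rw [← heq hz]; exact hd z t ht
  · simpa only [hΦ0] using hdist _ _ (hd z) (hd w) t ht
  · have := hdist ζ (Φ (ζ 0)) (fun t ht => by rw [heq (hζR t ht)]; exact hζ t ht) (hd _) t ht
    rw [hΦ0, sub_self, norm_zero, mul_zero] at this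
    exact sub_eq_zero.1 (norm_le_zero_iff.1 this)

end Flow

/-! ### The geodesic equation as a first-order system -/

section Spray

variable {n : ℕ}

theorem coeff_symm (g : Metric n) (x v w : EuclideanSpace ℝ (Fin n)) :
    coeff g x v w = coeff g x w v := g.symm x v w

theorem coeff_pos (g : Metric n) (x : EuclideanSpace ℝ (Fin n)) {v : EuclideanSpace ℝ (Fin n)}
    (hv : v ≠ 0) : 0 < coeff g x v v := g.pos x v hv

/-- Positive definiteness gives injectivity, and a space and its dual have equal dimension. -/
theorem coeff_isInvertible (g : Metric n) (x : EuclideanSpace ℝ (Fin n)) :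
    (coeff g x).IsInvertible := by
  have hinj : Function.Injective (coeff g x).toLinearMap := by
    rw [← LinearMap.ker_eq_bot, LinearMap.ker_eq_bot']
    intro v hv
    by_contra hne
    have h1 := coeff_pos g x hne
    have h2 : coeff g x v = 0 := hv
    rw [h2] at h1
    simp at h1
  have hfin : Module.finrank ℝ (EuclideanSpace ℝ (Fin n)) =
      Module.finrank ℝ (EuclideanSpace ℝ (Fin n) →L[ℝ] ℝ) := by
    rw [← (LinearMap.toContinuousLinearMap (𝕜 := ℝ) (E := EuclideanSpace ℝ (Fin n))
      (F' := ℝ)).finrank_eq]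
    exact (Subspace.dual_finrank_eq (K := ℝ) (V := EuclideanSpace ℝ (Fin n))).symm
  refine ⟨(LinearEquiv.ofInjectiveOfFinrankEq _ hinj hfin).toContinuousLinearEquiv, ?_⟩
  ext v w
  rfl

/-- The Christoffel symbols of the first kind `u ↦ Γ(v, v; u)` as a linear form. -/
noncomputable def christoffelForm (g : Metric n) (x v : EuclideanSpace ℝ (Fin n)) :
    EuclideanSpace ℝ (Fin n) →L[ℝ] ℝ :=
  fderiv ℝ (coeff g) x v v - (1 / 2 : ℝ) • ((fderiv ℝ (coeff g) x).flip v).flip v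

theorem christoffelForm_apply (g : Metric n) (x v u : EuclideanSpace ℝ (Fin n)) :
    christoffelForm g x v u = christoffel g x v v u := by
  simp only [christoffelForm, christoffel, _root_.sub_apply,
    _root_.smul_apply, ContinuousLinearMap.flip_apply, smul_eq_mul]
  ring

/-- The coordinate acceleration of the geodesic through `p.1` with velocity `p.2`. -/
noncomputable def spray (g : Metric n)
    (p : EuclideanSpace ℝ (Fin n) × EuclideanSpace ℝ (Fin n)) : EuclideanSpace ℝ (Fin n) :=
  -(coeff g p.1).inverse (christoffelForm g p.1 p.2)

theorem coeff_spray (g : Metric n) (p : EuclideanSpace ℝ (Fin n) × EuclideanSpace ℝ (Fin n))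
    (u : EuclideanSpace ℝ (Fin n)) :
    coeff g p.1 (spray g p) u + christoffel g p.1 p.2 p.2 u = 0 := by
  have h : coeff g p.1 ((coeff g p.1).inverse (christoffelForm g p.1 p.2))
      = christoffelForm g p.1 p.2 := by
    obtain ⟨e, he⟩ := coeff_isInvertible g p.1
    rw [← he, ContinuousLinearMap.inverse_equiv]
    simp
  rw [spray, map_neg, h, _root_.neg_apply, christoffelForm_apply, neg_add_cancel]

theorem eq_spray_of_coeff (g : Metric n) {x v a : EuclideanSpace ℝ (Fin n)}
    (h : ∀ u, coeff g x a u + christoffel g x v v u = 0) : a = spray g (x, v) := by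
  by_contra hne
  have h1 := coeff_pos g x (sub_ne_zero.2 hne)
  have h2 := h (a - spray g (x, v))
  have h3 := coeff_spray g (x, v) (a - spray g (x, v))
  simp only at h3
  have h4 := congrArg (fun f => f (a - spray g (x, v))) (map_sub (coeff g x) a (spray g (x, v)))
  simp only [_root_.sub_apply] at h4
  linarith

/-- The Christoffel term is quadratic in the velocity. This homogeneity underlies both affine
reparametrization and the vanishing of the derivative at zero velocity. -/
theorem spray_smul (g : Metric n) (x v : EuclideanSpace ℝ (Fin n)) (c : ℝ) :
    spray g (x, c • v) = c ^ 2 • spray g (x, v) := by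
  symm
  refine eq_spray_of_coeff g fun u => ?_
  have h := coeff_spray g (x, v) u
  simp only [christoffel, map_smul, _root_.smul_apply, smul_eq_mul] at h ⊢
  linear_combination c ^ 2 * h

set_option maxSynthPendingDepth 3 in
theorem contDiff_spray (g : Metric n) : ContDiff ℝ 1 (spray g) := by
  have hfst : ContDiff ℝ 1 fun p : EuclideanSpace ℝ (Fin n) × EuclideanSpace ℝ (Fin n) => p.1 :=
    contDiff_fst
  have hsnd : ContDiff ℝ 1 fun p : EuclideanSpace ℝ (Fin n) × EuclideanSpace ℝ (Fin n) => p.2 :=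
    contDiff_snd
  have hc : ContDiff ℝ 1 (coeff g) := (coeff_contDiff g).of_le (by exact_mod_cast le_top)
  have hD : ContDiff ℝ 1 (fderiv ℝ (coeff g)) :=
    (contDiff_infty.1 (coeff_contDiff g) 2).fderiv_right (by norm_num)
  have hinv : ContDiff ℝ 1 fun p : EuclideanSpace ℝ (Fin n) × EuclideanSpace ℝ (Fin n) =>
      (coeff g p.1).inverse := by
    rw [contDiff_iff_contDiffAt]
    intro p
    exact ((coeff_isInvertible g p.1).contDiffAt_map_inverse).comp p (hc.comp hfst).contDiffAt
  have hform : ContDiff ℝ 1 fun p : EuclideanSpace ℝ (Fin n) × EuclideanSpace ℝ (Fin n) =>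
      christoffelForm g p.1 p.2 := by
    rw [contDiff_clm_apply_iff]
    intro u
    simp only [christoffelForm, _root_.sub_apply,
      _root_.smul_apply, ContinuousLinearMap.flip_apply]
    have h1 := ((((hD.comp hfst).clm_apply hsnd).clm_apply hsnd).clm_apply
      (contDiff_const (c := u)))
    have h2 := ((((hD.comp hfst).clm_apply (contDiff_const (c := u))).clm_apply hsnd).clm_apply
      hsnd)
    exact h1.sub (h2.const_smul (1 / 2 : ℝ))
  exact (hinv.clm_apply hform).neg

/-- The spray is quadratic in the velocity, so its derivative at zero velocity vanishes. -/
theorem hasStrictFDerivAt_spray_zero (g : Metric n) (x : EuclideanSpace ℝ (Fin n)) :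
    HasStrictFDerivAt (spray g) (0 : _ →L[ℝ] EuclideanSpace ℝ (Fin n)) (x, 0) := by
  have hs := (contDiff_spray g).contDiffAt (x := (x, 0)).hasStrictFDerivAt one_ne_zero
  suffices h : fderiv ℝ (spray g) (x, 0) = 0 by rwa [h] at hs
  refine ContinuousLinearMap.ext fun p => ?_
  obtain ⟨h, k⟩ := p
  have hline : HasDerivAt (fun t : ℝ => ((x, 0) : EuclideanSpace ℝ (Fin n) × _) + t • (h, k))
      (h, k) 0 := by
    simpa using ((hasDerivAt_id (0 : ℝ)).smul_const (h, k)).const_add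
      ((x, 0) : EuclideanSpace ℝ (Fin n) × _)
  have h1 : HasDerivAt (fun t : ℝ => spray g (x + t • h, t • k))
      (fderiv ℝ (spray g) (x, 0) (h, k)) 0 := by
    have hs' : HasFDerivAt (spray g) (fderiv ℝ (spray g) (x, 0))
        ((fun t : ℝ => ((x, 0) : EuclideanSpace ℝ (Fin n) × _) + t • (h, k)) 0) := by
      simpa using hs.hasFDerivAt
    simpa [Function.comp_def] using hs'.comp_hasDerivAt 0 hline
  -- By homogeneity the function is `t ^ 2` times a differentiable one.
  have h2 : HasDerivAt (fun t : ℝ => spray g (x + t • h, t • k)) 0 0 := by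
    simp only [spray_smul]
    have hf : DifferentiableAt ℝ (fun t : ℝ => spray g (x + t • h, k)) 0 := by
      have := ((contDiff_spray g).differentiable one_ne_zero)
      fun_prop
    have := ((hasDerivAt_id' (0 : ℝ)).fun_pow 2).fun_smul hf.hasDerivAt
    simpa using this
  exact h1.unique h2

/-- The geodesic vector field on the tangent bundle. -/
noncomputable def geodesicField (g : Metric n)
    (p : EuclideanSpace ℝ (Fin n) × EuclideanSpace ℝ (Fin n)) :
    EuclideanSpace ℝ (Fin n) × EuclideanSpace ℝ (Fin n) :=
  (p.2, spray g p)

theorem contDiff_geodesicField (g : Metric n) : ContDiff ℝ 1 (geodesicField g) :=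
  contDiff_snd.prodMk (contDiff_spray g)

/-- An integral curve of the geodesic vector field on `[0,1]`. -/
def IsGeodesicLift (g : Metric n)
    (z : ℝ → EuclideanSpace ℝ (Fin n) × EuclideanSpace ℝ (Fin n)) : Prop :=
  ∀ t ∈ Icc (0 : ℝ) 1, HasDerivWithinAt z (geodesicField g (z t)) (Icc 0 1) t

theorem IsGeodesic.exists_lift {g : Metric n} {γ : ℝ → EuclideanSpace ℝ (Fin n)}
    (h : IsGeodesic g γ) : ∃ v : ℝ → EuclideanSpace ℝ (Fin n), IsGeodesicLift g fun t => (γ t, v t) := by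
  obtain ⟨v, a, hva⟩ := h
  refine ⟨v, fun t ht => ?_⟩
  obtain ⟨h1, h2, h3⟩ := hva t ht
  rw [eq_spray_of_coeff g h3] at h2
  exact h1.prodMk h2

theorem IsGeodesicLift.hasDerivWithinAt_fst {g : Metric n}
    {z : ℝ → EuclideanSpace ℝ (Fin n) × EuclideanSpace ℝ (Fin n)} (h : IsGeodesicLift g z)
    {t : ℝ} (ht : t ∈ Icc (0 : ℝ) 1) :
    HasDerivWithinAt (fun t => (z t).1) (z t).2 (Icc 0 1) t :=
  (ContinuousLinearMap.fst ℝ (EuclideanSpace ℝ (Fin n))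
    (EuclideanSpace ℝ (Fin n))).hasFDerivAt.comp_hasDerivWithinAt t (h t ht)

theorem IsGeodesicLift.hasDerivWithinAt_snd {g : Metric n}
    {z : ℝ → EuclideanSpace ℝ (Fin n) × EuclideanSpace ℝ (Fin n)} (h : IsGeodesicLift g z)
    {t : ℝ} (ht : t ∈ Icc (0 : ℝ) 1) :
    HasDerivWithinAt (fun t => (z t).2) (spray g (z t)) (Icc 0 1) t :=
  (ContinuousLinearMap.snd ℝ (EuclideanSpace ℝ (Fin n))
    (EuclideanSpace ℝ (Fin n))).hasFDerivAt.comp_hasDerivWithinAt t (h t ht)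

theorem IsGeodesicLift.isGeodesic {g : Metric n}
    {z : ℝ → EuclideanSpace ℝ (Fin n) × EuclideanSpace ℝ (Fin n)} (h : IsGeodesicLift g z) :
    IsGeodesic g fun t => (z t).1 :=
  ⟨fun t => (z t).2, fun t => spray g (z t), fun _ ht =>
    ⟨h.hasDerivWithinAt_fst ht, h.hasDerivWithinAt_snd ht, coeff_spray g _⟩⟩

theorem IsGeodesicLift.continuousOn {g : Metric n}
    {z : ℝ → EuclideanSpace ℝ (Fin n) × EuclideanSpace ℝ (Fin n)} (h : IsGeodesicLift g z) :
    ContinuousOn z (Icc 0 1) := fun t ht => (h t ht).continuousWithinAt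

/-- Both curves are bounded on `[0,1]`, so a single truncated flow contains them. -/
theorem IsGeodesicLift.eqOn {g : Metric n}
    {z w : ℝ → EuclideanSpace ℝ (Fin n) × EuclideanSpace ℝ (Fin n)} (hz : IsGeodesicLift g z)
    (hw : IsGeodesicLift g w) (h0 : z 0 = w 0) : EqOn z w (Icc 0 1) := by
  obtain ⟨R, hR⟩ := isCompact_Icc.exists_bound_of_continuousOn hz.continuousOn
  obtain ⟨S, hS⟩ := isCompact_Icc.exists_bound_of_continuousOn hw.continuousOn
  obtain ⟨Φ, L, -, -, -, -, hΦ⟩ := exists_flow (contDiff_geodesicField g) (max R S)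
  have h1 := hΦ z hz fun t ht => mem_closedBall_zero_iff.2 ((hR t ht).trans (le_max_left _ _))
  have h2 := hΦ w hw fun t ht => mem_closedBall_zero_iff.2 ((hS t ht).trans (le_max_right _ _))
  rw [h0] at h1
  exact h1.trans h2.symm

/-- Affine reparametrizations of geodesics are geodesics. -/
theorem IsGeodesicLift.comp_affine {g : Metric n}
    {z : ℝ → EuclideanSpace ℝ (Fin n) × EuclideanSpace ℝ (Fin n)} (hz : IsGeodesicLift g z)
    {a b : ℝ} (hab : ∀ t ∈ Icc (0 : ℝ) 1, a + b * t ∈ Icc (0 : ℝ) 1) :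
    IsGeodesicLift g fun t => ((z (a + b * t)).1, b • (z (a + b * t)).2) := by
  intro t ht
  have hτ : HasDerivWithinAt (fun t : ℝ => a + b * t) b (Icc 0 1) t := by
    simpa using (((hasDerivAt_id t).const_mul b).const_add a).hasDerivWithinAt
  have h1 := (hz.hasDerivWithinAt_fst (hab t ht)).scomp t hτ hab
  have h2 := ((hz.hasDerivWithinAt_snd (hab t ht)).scomp t hτ hab).const_smul b
  have h3 := h1.prodMk h2
  simp only [Function.comp_def] at h3
  refine h3.congr_deriv ?_
  rw [geodesicField, spray_smul, smul_smul, pow_two]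

set_option maxSynthPendingDepth 3 in
/-- Geodesics have constant speed. -/
theorem IsGeodesicLift.coeff_eq {g : Metric n}
    {z : ℝ → EuclideanSpace ℝ (Fin n) × EuclideanSpace ℝ (Fin n)} (hz : IsGeodesicLift g z)
    {t : ℝ} (ht : t ∈ Icc (0 : ℝ) 1) :
    coeff g (z t).1 (z t).2 (z t).2 = coeff g (z 0).1 (z 0).2 (z 0).2 := by
  have hd : ∀ t ∈ Icc (0 : ℝ) 1,
      HasDerivWithinAt (fun t => coeff g (z t).1 (z t).2 (z t).2) 0 (Icc 0 1) t := by
    intro t ht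
    have hc : HasFDerivAt (coeff g) (fderiv ℝ (coeff g) (z t).1) (z t).1 :=
      ((coeff_contDiff g).differentiable (by simp) _).hasFDerivAt
    have h1 := hc.comp_hasDerivWithinAt t (hz.hasDerivWithinAt_fst ht)
    have h2 := hz.hasDerivWithinAt_snd ht
    have h3 := (h1.clm_apply h2).clm_apply h2
    simp only [Function.comp_def] at h3
    refine h3.congr_deriv ?_
    -- Tested against the velocity `v` itself, the Christoffel term collapses to half of `D_v g(v,
    -- v)`, which cancels the derivative of the metric.
    have h4 := coeff_spray g (z t) (z t).2
    rw [christoffel] at h4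
    rw [_root_.add_apply, coeff_symm g _ (z t).2 (spray g (z t))]
    linear_combination 2 * h4
  have h := (convex_Icc (0 : ℝ) 1).norm_image_sub_le_of_norm_hasDerivWithin_le (C := 0) hd
    (by simp) (by simp : (0 : ℝ) ∈ Icc (0 : ℝ) 1) ht
  rw [zero_mul] at h
  exact sub_eq_zero.1 (norm_le_zero_iff.1 h)

end Spray

/-! ### Short geodesics and the velocity bound -/

section ShortGeodesics

variable {n : ℕ}

theorem spray_zero (g : Metric n) (x : EuclideanSpace ℝ (Fin n)) : spray g (x, 0) = 0 := by
  simpa using spray_smul g x 0 0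

theorem isGeodesicLift_const (g : Metric n) (x : EuclideanSpace ℝ (Fin n)) :
    IsGeodesicLift g fun _ => (x, 0) := by
  intro t _
  have : geodesicField g (x, 0) = 0 := by rw [geodesicField, spray_zero]; rfl
  rw [this]
  exact hasDerivWithinAt_const _ _ _

/-- Integrating the difference of accelerations twice over `[0,1]`. For a common starting point it
measures how far the map from initial velocity to end point is from a translation. -/
theorem IsGeodesicLift.norm_sub_sub_le {g : Metric n}
    {z w : ℝ → EuclideanSpace ℝ (Fin n) × EuclideanSpace ℝ (Fin n)} (hz : IsGeodesicLift g z)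
    (hw : IsGeodesicLift g w) {C : ℝ}
    (hC : ∀ t ∈ Icc (0 : ℝ) 1, ‖spray g (z t) - spray g (w t)‖ ≤ C) :
    ‖(z 1).1 - (w 1).1 - ((z 0).1 - (w 0).1) - ((z 0).2 - (w 0).2)‖ ≤ C := by
  have h0 : (0 : ℝ) ∈ Icc (0 : ℝ) 1 := by simp
  have hC0 : 0 ≤ C := (norm_nonneg _).trans (hC 0 h0)
  have h1 : ∀ t ∈ Icc (0 : ℝ) 1, ‖(z t).2 - (w t).2 - ((z 0).2 - (w 0).2)‖ ≤ C := by
    intro t ht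
    have h := (convex_Icc (0 : ℝ) 1).norm_image_sub_le_of_norm_hasDerivWithin_le
      (fun t ht => (hz.hasDerivWithinAt_snd ht).fun_sub (hw.hasDerivWithinAt_snd ht)) hC h0 ht
    refine h.trans (mul_le_of_le_one_right hC0 ?_)
    rw [sub_zero, Real.norm_of_nonneg ht.1]
    exact ht.2
  have h2 := (convex_Icc (0 : ℝ) 1).norm_image_sub_le_of_norm_hasDerivWithin_le
    (fun t ht => ((hz.hasDerivWithinAt_fst ht).fun_sub (hw.hasDerivWithinAt_fst ht)).fun_sub
      ((hasDerivWithinAt_id t _).smul_const ((z 0).2 - (w 0).2)))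
    (by simpa using h1) h0 (by simp : (1 : ℝ) ∈ Icc (0 : ℝ) 1)
  simp only [id, one_smul, zero_smul, sub_zero, norm_one, mul_one] at h2
  rwa [sub_right_comm]

/-- Any two points near `p` are joined by a short geodesic. -/
theorem exists_short_geodesics (g : Metric n) {U : Set (EuclideanSpace ℝ (Fin n))}
    (hU : IsOpen U) {p : EuclideanSpace ℝ (Fin n)} (hp : p ∈ U) {ε : ℝ} (hε : 0 < ε) :
    ∃ N ∈ 𝓝 p, ∀ q ∈ N, ∀ q' ∈ N, ∃ z, IsGeodesicLift g z ∧
      (∀ t ∈ Icc (0 : ℝ) 1, (z t).1 ∈ U) ∧ (z 0).1 = q ∧ (z 1).1 = q' ∧ ‖(z 0).2‖ ≤ ε := by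
  obtain ⟨Φ, L, hL, hΦ0, hΦd, hΦL, hΦu⟩ := exists_flow (contDiff_geodesicField g) (‖p‖ + 1)
  have hc : 0 < 1 / (2 * L) := by positivity
  -- The constant `1 / (2 * L)` offsets the Lipschitz constant `L` of the flow, so that the
  -- end-point map will be `1 / 2`-close to the identity.
  obtain ⟨s, hs, hlip⟩ := (hasStrictFDerivAt_spray_zero g p).exists_lipschitzOnWith_of_nnnorm_lt
    ⟨1 / (2 * L), hc.le⟩ (by rw [nnnorm_zero]; exact_mod_cast hc)
  have hball : Metric.closedBall (0 : EuclideanSpace ℝ (Fin n) × EuclideanSpace ℝ (Fin n))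
      (‖p‖ + 1) ∈ 𝓝 ((p, 0) : EuclideanSpace ℝ (Fin n) × EuclideanSpace ℝ (Fin n)) := by
    refine mem_of_superset (Metric.isOpen_ball.mem_nhds ?_) Metric.ball_subset_closedBall
    rw [mem_ball_zero_iff, Prod.norm_def]
    simp
  have hUn : Prod.fst ⁻¹' U ∈ 𝓝 ((p, 0) : EuclideanSpace ℝ (Fin n) × EuclideanSpace ℝ (Fin n)) :=
    continuous_fst.continuousAt (hU.mem_nhds hp)
  obtain ⟨r, hr, hrs⟩ := Metric.mem_nhds_iff.1 (inter_mem (inter_mem hs hUn) hball)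
  have hconst : ∀ x ∈ Metric.ball p r, ∀ t ∈ Icc (0 : ℝ) 1, Φ (x, 0) t = (x, 0) := by
    intro x hx t ht
    refine (hΦu _ (isGeodesicLift_const g x) (fun t _ => (hrs ?_).2) ht).symm
    rw [Metric.mem_ball, Prod.dist_eq]
    simpa using hx
  -- The three bounds: initial velocity at most `ε`; trajectories within `L * ρ ≤ r / 2` of `(p,
  -- 0)`; `ρ < r`.
  set ρ := min ε (min (r / (2 * L)) (r / 2)) with hρdef
  have hρ : 0 < ρ := by positivity
  have hρr : ρ < r :=
    ((min_le_right _ _).trans (min_le_right _ _)).trans_lt (half_lt_self hr)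
  have hin : ∀ x ∈ Metric.closedBall p ρ, ∀ w ∈ Metric.closedBall (0 : EuclideanSpace ℝ (Fin n)) ρ,
      ∀ t ∈ Icc (0 : ℝ) 1, Φ (x, w) t ∈ Metric.ball (p, 0) r := by
    intro x hx w hw t ht
    rw [mem_ball_iff_norm]
    have h1 := hΦL (x, w) (p, 0) t ht
    rw [hconst p (Metric.mem_ball_self hr) t ht] at h1
    refine h1.trans_lt ?_
    have h2 : ‖((x, w) : EuclideanSpace ℝ (Fin n) × EuclideanSpace ℝ (Fin n)) - (p, 0)‖ ≤ ρ := by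
      rw [Prod.norm_def]
      exact max_le (by simpa using mem_closedBall_iff_norm.1 hx) (by simpa using hw)
    calc _ ≤ L * (r / (2 * L)) := by
          gcongr
          exact h2.trans ((min_le_right _ _).trans (min_le_left _ _))
      _ = r / 2 := by field_simp
      _ < r := half_lt_self hr
  have hlift : ∀ x ∈ Metric.closedBall p ρ,
      ∀ w ∈ Metric.closedBall (0 : EuclideanSpace ℝ (Fin n)) ρ, IsGeodesicLift g (Φ (x, w)) :=
    fun x hx w hw t ht => hΦd _ t ht (hrs (hin x hx w hw t ht)).2
  -- Velocities of norm at most `ρ` reach every point within `(1 - 1 / 2) * ρ` of `q`, and two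
  -- points of this ball are less than `ρ / 2` apart.
  refine ⟨Metric.ball p (ρ / 4), Metric.ball_mem_nhds _ (by positivity), fun q hq q' hq' => ?_⟩
  have hqρ : q ∈ Metric.closedBall p ρ :=
    Metric.ball_subset_closedBall (Metric.ball_subset_ball (by linarith) hq)
  have happ : ApproximatesLinearOn (fun w => (Φ (q, w) 1).1)
      (ContinuousLinearMap.id ℝ (EuclideanSpace ℝ (Fin n)))
      (Metric.closedBall (0 : EuclideanSpace ℝ (Fin n)) ρ) (1 / 2) := by
    intro w hw w' hw'
    have h1 := (hlift q hqρ w hw).norm_sub_sub_le (hlift q hqρ w' hw')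
      (C := 1 / 2 * ‖w - w'‖) (fun t ht => by
        have h2 := hlip.dist_le_mul _ (hrs (hin q hqρ w hw t ht)).1.1 _
          (hrs (hin q hqρ w' hw' t ht)).1.1
        have h3 := hΦL (q, w) (q, w') t ht
        have h4 : ‖(q, w) - (q, w')‖ = ‖w - w'‖ := by
          rw [Prod.mk_sub_mk, sub_self, Prod.norm_mk, norm_zero, max_eq_right (norm_nonneg _)]
        rw [h4] at h3
        rw [dist_eq_norm, dist_eq_norm] at h2
        calc _ ≤ _ := h2
          _ ≤ 1 / (2 * L) * (L * ‖w - w'‖) := mul_le_mul_of_nonneg_left h3 hc.le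
          _ = _ := by field_simp)
    have h2 : ((1 / 2 : NNReal) : ℝ) = 1 / 2 := by norm_num
    simp only [hΦ0, sub_self, sub_zero] at h1
    rw [h2]
    exact h1
  let inv : (ContinuousLinearMap.id ℝ (EuclideanSpace ℝ (Fin n))).NonlinearRightInverse :=
    { toFun := id
      nnnorm := 1
      bound' := fun y => by simp
      right_inv' := fun y => rfl }
  have hsurj := happ.surjOn_closedBall_of_nonlinearRightInverse inv hρ.le Subset.rfl
  have hq1 : (Φ (q, 0) 1).1 = q := by
    rw [hconst q (Metric.closedBall_subset_ball hρr hqρ) 1 (by simp)]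
  have hq'm : q' ∈ Metric.closedBall (Φ (q, 0) 1).1
      ((((inv.nnnorm : NNReal) : ℝ)⁻¹ - ((1 / 2 : NNReal) : ℝ)) * ρ) := by
    rw [hq1, Metric.mem_closedBall]
    have h4 := dist_triangle_right q' q p
    rw [Metric.mem_ball] at hq hq'
    have h5 : (((inv.nnnorm : NNReal) : ℝ)⁻¹ - ((1 / 2 : NNReal) : ℝ)) * ρ
        = ρ / 2 := by
      simp only [inv, NNReal.coe_one, NNReal.coe_div, NNReal.coe_ofNat]; ring
    rw [h5]; linarith
  obtain ⟨w, hw, hwq⟩ := hsurj hq'm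
  refine ⟨Φ (q, w), hlift q hqρ w hw, fun t ht => (hrs (hin q hqρ w hw t ht)).1.2,
    by rw [hΦ0], hwq, ?_⟩
  rw [hΦ0]
  exact (mem_closedBall_zero_iff.1 hw).trans (min_le_left _ _)

theorem IsGeodesicLift.joinsIn {g : Metric n} {U : Set (EuclideanSpace ℝ (Fin n))}
    {z : ℝ → EuclideanSpace ℝ (Fin n) × EuclideanSpace ℝ (Fin n)} (hz : IsGeodesicLift g z)
    (hzU : ∀ t ∈ Icc (0 : ℝ) 1, (z t).1 ∈ U) :
    JoinsIn g U (z 0).1 (z 1).1 fun t => (z t).1 :=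
  ⟨hz.isGeodesic, hzU, rfl, rfl⟩

/-- In a `g`-convex set the initial velocity of a geodesic is determined by its end points. -/
theorem IsGConvex.velocity_eq {g : Metric n} {U : Set (EuclideanSpace ℝ (Fin n))}
    (hU : IsGConvex g U) {x y v w : EuclideanSpace ℝ (Fin n)}
    {γ η : ℝ → EuclideanSpace ℝ (Fin n)} (hγ : JoinsIn g U x y γ) (hη : JoinsIn g U x y η)
    (hv : HasDerivWithinAt γ v (Icc 0 1) 0) (hw : HasDerivWithinAt η w (Icc 0 1) 0) : v = w := by
  have h0 : (0 : ℝ) ∈ Icc (0 : ℝ) 1 := by simp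
  have hx : x ∈ U := hγ.2.2.1 ▸ hγ.2.1 h0
  have hy : y ∈ U := hγ.2.2.2 ▸ hγ.2.1 (by simp)
  obtain ⟨ζ, -, hζ⟩ := hU x hx y hy
  have heq : EqOn η γ (Icc 0 1) := (hζ η hη).trans (hζ γ hγ).symm
  exact (uniqueDiffOn_Icc zero_lt_one 0 h0).eq_deriv _ hv (hw.congr heq.symm (heq.symm h0))

/-- Compactness of `K` times the unit sphere, then homogeneity in `v`. -/
theorem exists_coeff_lower_bound (g : Metric n) {K : Set (EuclideanSpace ℝ (Fin n))}
    (hK : IsCompact K) : ∃ m > 0, ∀ x ∈ K, ∀ v, m * ‖v‖ ^ 2 ≤ coeff g x v v := by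
  have hc : Continuous fun p : EuclideanSpace ℝ (Fin n) × EuclideanSpace ℝ (Fin n) =>
      coeff g p.1 p.2 p.2 :=
    (((coeff_contDiff g).continuous.comp continuous_fst).clm_apply continuous_snd).clm_apply
      continuous_snd
  obtain ⟨m, hm, hmK⟩ : ∃ m > 0, ∀ p ∈ K ×ˢ Metric.sphere (0 : EuclideanSpace ℝ (Fin n)) 1,
      m ≤ coeff g p.1 p.2 p.2 := by
    refine (hK.prod (isCompact_sphere _ _)).exists_forall_le' hc.continuousOn fun p hp => ?_
    refine coeff_pos g p.1 ?_
    rintro h0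
    have := hp.2
    rw [h0] at this
    simp at this
  refine ⟨m, hm, fun x hx v => ?_⟩
  by_cases hv : v = 0
  · simp [hv]
  · have hv' : ‖v‖ ≠ 0 := norm_ne_zero_iff.2 hv
    have h := hmK (x, ‖v‖⁻¹ • v) ⟨hx, by simp [norm_smul, hv']⟩
    simp only [map_smul, _root_.smul_apply, smul_eq_mul] at h
    calc m * ‖v‖ ^ 2 ≤ (‖v‖⁻¹ * (‖v‖⁻¹ * coeff g x v v)) * ‖v‖ ^ 2 := by gcongr
      _ = _ := by field_simp

set_option maxSynthPendingDepth 3 in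
/-- In a `g`-convex set, geodesics that stay in a compact set have bounded velocity: a long one
would return close to one of its earlier points, to which it is also joined by a short one. -/
theorem IsGConvex.exists_velocity_bound {g : Metric n} {U : Set (EuclideanSpace ℝ (Fin n))}
    (hUg : IsGConvex g U) (hU : IsOpen U) {K : Set (EuclideanSpace ℝ (Fin n))}
    (hK : IsCompact K) (hKU : K ⊆ U) :
    ∃ C, ∀ z, IsGeodesicLift g z → (∀ t ∈ Icc (0 : ℝ) 1, (z t).1 ∈ K) →
      ∀ t ∈ Icc (0 : ℝ) 1, ‖(z t).2‖ ≤ C := by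
  obtain ⟨m, hm, hmK⟩ := exists_coeff_lower_bound g hK
  obtain ⟨M, hM⟩ := hK.exists_bound_of_continuousOn (f := coeff g) (coeff_contDiff g).continuous.continuousOn
  -- Since `‖g‖ ≤ M` on `K`, a vector of norm at most this has squared `g`-length below `1`.
  have hε : 0 < 1 / (|M| + 1) := by positivity
  choose! N hN hNs using fun p (hp : p ∈ K) => exists_short_geodesics g hU (hKU hp) hε
  obtain ⟨T, hTK, hT⟩ := hK.elim_nhds_subcover N hN
  refine ⟨√((T.card : ℝ) ^ 2 / m), fun z hz hzK => ?_⟩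
  set k := T.card with hk
  have h0 : (0 : ℝ) ∈ Icc (0 : ℝ) 1 := by simp
  choose! c hcT hc using fun x (hx : x ∈ K) => mem_iUnion₂.1 (hT hx)
  have hkpos : (0 : ℝ) < k := by
    exact_mod_cast Finset.card_pos.2 ⟨_, hcT _ (hzK 0 h0)⟩
  have hpt : ∀ j ∈ Finset.range (k + 1), (j : ℝ) / k ∈ Icc (0 : ℝ) 1 := fun j hj => by
    refine ⟨by positivity, (div_le_one hkpos).2 ?_⟩
    exact_mod_cast Finset.mem_range_succ_iff.1 hj
  -- The `k + 1` times `j / k` fall into `k` neighbourhoods. The cover depends only on `K`, so the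
  -- bound is uniform in `z`.
  have hpigeon : ∃ i j : ℕ, i < j ∧ i ∈ Finset.range (k + 1) ∧ j ∈ Finset.range (k + 1) ∧
      c (z ((i : ℝ) / k)).1 = c (z ((j : ℝ) / k)).1 := by
    obtain ⟨i, hi, j, hj, hij, he⟩ := Finset.exists_ne_map_eq_of_card_lt_of_maps_to
      (s := Finset.range (k + 1)) (t := T) (f := fun j : ℕ => c (z ((j : ℝ) / k)).1)
      (by simp [hk]) fun j hj => hcT _ (hzK _ (hpt j hj))
    rcases hij.lt_or_gt with h | h
    · exact ⟨i, j, h, hi, hj, he⟩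
    · exact ⟨j, i, h, hj, hi, he.symm⟩
  obtain ⟨i, j, hij, hi, hj, he⟩ := hpigeon
  have hi' := hzK _ (hpt i hi)
  have hj' := hzK _ (hpt j hj)
  obtain ⟨w, hw, hwU, hw0, hw1, hwε⟩ := hNs _ (hTK _ (hcT _ hi')) _ (hc _ hi') _
    (he ▸ hc _ hj')
  set b : ℝ := (j : ℝ) / k - (i : ℝ) / k with hb
  have hab : ∀ t ∈ Icc (0 : ℝ) 1, (i : ℝ) / k + b * t ∈ Icc (0 : ℝ) 1 := by
    intro t ht
    have h1 := (convex_Icc (0 : ℝ) 1) (hpt i hi) (hpt j hj) (sub_nonneg.2 ht.2) ht.1 (by ring)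
    simp only [smul_eq_mul] at h1
    convert h1 using 1
    rw [hb]; ring
  have hζ := hz.comp_affine hab
  -- The piece of `z` between the two times, rescaled to `[0,1]`, has the same end points as the
  -- short geodesic `w`, hence the same initial velocity.
  have hvel := hUg.velocity_eq (hζ.joinsIn fun t ht => hKU (hzK _ (hab t ht)))
    (by
      have := hw.joinsIn hwU
      rw [hw0, hw1] at this
      simpa only [mul_zero, add_zero, mul_one, hb, add_sub_cancel] using this) (hζ.hasDerivWithinAt_fst h0) (hw.hasDerivWithinAt_fst h0)
  simp only [mul_zero, add_zero] at hvel
  have hbk : 1 / (k : ℝ) ≤ b := by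
    rw [hb, ← sub_div]
    gcongr
    have : (i : ℝ) + 1 ≤ j := by exact_mod_cast hij
    linarith
  -- Constant speed transfers the smallness of `w` to all of `z`; with `b ≥ 1 / k` the squared speed
  -- is below `k ^ 2`.
  have hE : b ^ 2 * coeff g (z 0).1 (z 0).2 (z 0).2 < 1 := by
    rw [← hz.coeff_eq (hpt i hi)]
    have h2 : b ^ 2 * coeff g (z (i / k)).1 (z (i / k)).2 (z (i / k)).2
        = coeff g (z (i / k)).1 (w 0).2 (w 0).2 := by
      rw [← hvel]
      simp only [map_smul, _root_.smul_apply, smul_eq_mul]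
      ring
    rw [h2]
    calc coeff g (z (i / k)).1 (w 0).2 (w 0).2
        ≤ ‖coeff g (z (i / k)).1‖ * ‖(w 0).2‖ * ‖(w 0).2‖ :=
          (Real.le_norm_self _).trans ((coeff g _).le_opNorm₂ _ _)
      _ ≤ |M| * (1 / (|M| + 1)) * (1 / (|M| + 1)) := by
          gcongr
          exact (hM _ hi').trans (le_abs_self M)
      _ < 1 := by
          have : 0 ≤ |M| := abs_nonneg M
          rw [mul_one_div, mul_one_div, div_div, div_lt_one (by positivity)]
          nlinarith
  intro t ht
  refine Real.le_sqrt_of_sq_le ?_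
  rw [le_div_iff₀ hm, mul_comm]
  refine (hmK _ (hzK t ht) _).trans ?_
  rw [hz.coeff_eq ht]
  have hE0 : 0 ≤ coeff g (z 0).1 (z 0).2 (z 0).2 :=
    le_trans (by positivity) (hmK _ (hzK 0 h0) (z 0).2)
  have h3 : (1 / (k : ℝ)) ^ 2 * coeff g (z 0).1 (z 0).2 (z 0).2 < 1 :=
    lt_of_le_of_lt (by gcongr) hE
  rw [one_div, inv_pow, inv_mul_lt_iff₀ (by positivity), mul_one] at h3
  exact h3.le

end ShortGeodesics

/-! ### The inverse exponential map and its continuity -/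

section ExponentialMap

variable {n : ℕ}

/-- Slowing the geodesic down by the factor `t` gives a witness; the geodesic chosen inside `expMap`
has the same initial data, so it coincides with this one. -/
theorem IsGeodesicLift.smul_mem_expDomain {g : Metric n}
    {z : ℝ → EuclideanSpace ℝ (Fin n) × EuclideanSpace ℝ (Fin n)} (hz : IsGeodesicLift g z)
    {t : ℝ} (ht : t ∈ Icc (0 : ℝ) 1) :
    t • (z 0).2 ∈ expDomain g (z 0).1 ∧ expMap g (z 0).1 (t • (z 0).2) = (z t).1 := by
  have h0 : (0 : ℝ) ∈ Icc (0 : ℝ) 1 := by simp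
  have h1 : (1 : ℝ) ∈ Icc (0 : ℝ) 1 := by simp
  have hζ := hz.comp_affine (a := 0) (b := t) fun s hs => by
    rw [zero_add]; exact ⟨mul_nonneg ht.1 hs.1, mul_le_one₀ ht.2 hs.1 hs.2⟩
  simp only [zero_add] at hζ
  have hmem : t • (z 0).2 ∈ expDomain g (z 0).1 := by
    refine ⟨_, hζ.isGeodesic, by simp, ?_⟩
    simpa using hζ.hasDerivWithinAt_fst h0
  refine ⟨hmem, ?_⟩
  rw [expMap, dif_pos hmem]
  obtain ⟨hγ, hγ0, hγv⟩ := hmem.choose_spec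
  obtain ⟨v, hv⟩ := hγ.exists_lift
  have hv0 : v 0 = t • (z 0).2 :=
    (uniqueDiffOn_Icc zero_lt_one 0 h0).eq_deriv _ (hv.hasDerivWithinAt_fst h0) hγv
  have heq := hv.eqOn hζ (by simp [hγ0, hv0]) h1
  simpa using congrArg Prod.fst heq

/-- In a `g`-convex set, the initial velocity of the geodesic to a fixed point depends
continuously on the starting point if nearby geodesics stay in a common compact set. -/
theorem IsGConvex.continuousOn_velocity {g : Metric n} {U : Set (EuclideanSpace ℝ (Fin n))}
    (hUg : IsGConvex g U) (hU : IsOpen U) {y₀ : EuclideanSpace ℝ (Fin n)}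
    {Z : EuclideanSpace ℝ (Fin n) → ℝ → EuclideanSpace ℝ (Fin n) × EuclideanSpace ℝ (Fin n)}
    (hZ : ∀ x ∈ U, IsGeodesicLift g (Z x)) (hZU : ∀ x ∈ U, ∀ t ∈ Icc (0 : ℝ) 1, (Z x t).1 ∈ U)
    (hZ0 : ∀ x ∈ U, (Z x 0).1 = x) (hZ1 : ∀ x ∈ U, (Z x 1).1 = y₀)
    (hloc : ∀ x ∈ U, ∃ K ⊆ U, IsCompact K ∧
      ∀ᶠ y in 𝓝 x, ∀ t ∈ Icc (0 : ℝ) 1, (Z y t).1 ∈ K) :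
    ContinuousOn (fun x => (Z x 0).2) U := by
  intro x hx
  refine ContinuousAt.continuousWithinAt ?_
  have h0 : (0 : ℝ) ∈ Icc (0 : ℝ) 1 := by simp
  have h1 : (1 : ℝ) ∈ Icc (0 : ℝ) 1 := by simp
  obtain ⟨K, hKU, hK, hev⟩ := hloc x hx
  obtain ⟨C, hC⟩ := hUg.exists_velocity_bound hU hK hKU
  have hB : IsCompact (K ×ˢ Metric.closedBall (0 : EuclideanSpace ℝ (Fin n)) C) :=
    hK.prod (isCompact_closedBall _ _)
  obtain ⟨R, hR⟩ := hB.isBounded.subset_closedBall 0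
  obtain ⟨Φ, L, -, hΦ0, hΦd, hΦL, hΦu⟩ := exists_flow (contDiff_geodesicField g) R
  have hmem : ∀ᶠ y in 𝓝 x, y ∈ U ∧ ∀ t ∈ Icc (0 : ℝ) 1,
      Z y t ∈ K ×ˢ Metric.closedBall (0 : EuclideanSpace ℝ (Fin n)) C ∧
      Z y t = Φ (y, (Z y 0).2) t := by
    filter_upwards [hev, hU.mem_nhds hx] with y hy hyU
    have hb : ∀ t ∈ Icc (0 : ℝ) 1,
        Z y t ∈ K ×ˢ Metric.closedBall (0 : EuclideanSpace ℝ (Fin n)) C := fun t ht =>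
      ⟨hy t ht, mem_closedBall_zero_iff.2 (hC _ (hZ y hyU) hy t ht)⟩
    refine ⟨hyU, fun t ht => ⟨hb t ht, ?_⟩⟩
    have := hΦu (Z y) (hZ y hyU) (fun t ht => hR (hb t ht)) ht
    rwa [show Z y 0 = (y, (Z y 0).2) from Prod.ext (hZ0 y hyU) rfl] at this
  -- It suffices that each sequence tending to `x` has a subsequence with the right limit; the
  -- velocity bound supplies a limit `w` to be identified.
  refine tendsto_of_subseq_tendsto fun u hu => ?_
  have hu' := hu.eventually hmem
  obtain ⟨w, -, φ, hφ, hw⟩ := tendsto_subseq_of_frequently_bounded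
    (Metric.isBounded_closedBall (x := (0 : EuclideanSpace ℝ (Fin n))) (r := C))
    (x := fun k => (Z (u k) 0).2) (hu'.mono fun k hk => (hk.2 0 h0).1.2).frequently
  refine ⟨φ, ?_⟩
  have huφ := hu.comp hφ.tendsto_atTop
  have huφ' := huφ.eventually hmem
  have hpair : Tendsto (fun k => ((u (φ k), (Z (u (φ k)) 0).2) :
      EuclideanSpace ℝ (Fin n) × EuclideanSpace ℝ (Fin n))) atTop (𝓝 (x, w)) :=
    huφ.prodMk_nhds hw
  have hlim : ∀ t ∈ Icc (0 : ℝ) 1,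
      Tendsto (fun k => Z (u (φ k)) t) atTop (𝓝 (Φ (x, w) t)) := by
    intro t ht
    have h2 : Tendsto (fun k => Φ (u (φ k), (Z (u (φ k)) 0).2) t) atTop (𝓝 (Φ (x, w) t)) := by
      rw [tendsto_iff_norm_sub_tendsto_zero]
      refine squeeze_zero (fun _ => norm_nonneg _) (fun k => hΦL _ _ t ht) ?_
      simpa using (tendsto_iff_norm_sub_tendsto_zero.1 hpair).const_mul L
    refine h2.congr' ?_
    filter_upwards [huφ'] with k hk
    exact (hk.2 t ht).2.symm
  -- Closedness keeps the limit curve in the compact set, so it is a true geodesic, not just a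
  -- truncated one, and it lies in `U`.
  have hin : ∀ t ∈ Icc (0 : ℝ) 1,
      Φ (x, w) t ∈ K ×ˢ Metric.closedBall (0 : EuclideanSpace ℝ (Fin n)) C := fun t ht =>
    hB.isClosed.mem_of_tendsto (hlim t ht) (huφ'.mono fun k hk => (hk.2 t ht).1)
  have hlift : IsGeodesicLift g (Φ (x, w)) := fun t ht => hΦd _ t ht (hR (hin t ht))
  have hend : (Φ (x, w) 1).1 = y₀ := by
    refine tendsto_nhds_unique ((continuous_fst.tendsto _).comp (hlim 1 h1)) ?_
    refine tendsto_const_nhds.congr' ?_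
    filter_upwards [huφ'] with k hk
    exact (hZ1 _ hk.1).symm
  have hj := hlift.joinsIn fun t ht => hKU (hin t ht).1
  have hj' := (hZ x hx).joinsIn (hZU x hx)
  rw [hZ0 x hx, hZ1 x hx] at hj'
  rw [hΦ0, hend] at hj
  have hvel := hUg.velocity_eq hj hj' (hlift.hasDerivWithinAt_fst h0)
    ((hZ x hx).hasDerivWithinAt_fst h0)
  rw [hΦ0] at hvel
  simp only at hvel
  rw [hvel] at hw
  exact hw

/-- A function that is convex along a geodesic decreases to first order at its starting point by
at least the total decrease. -/
theorem IsLyapunov.fderiv_le_of_geodesic {g : Metric n} {U : Set (EuclideanSpace ℝ (Fin n))}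
    {G : EuclideanSpace ℝ (Fin n) → EuclideanSpace ℝ (Fin n)}
    {V : EuclideanSpace ℝ (Fin n) → ℝ} (hV : IsLyapunov U G V) (hVg : GConvexOn g U V)
    (hU : IsOpen U) {x y v : EuclideanSpace ℝ (Fin n)} {γ : ℝ → EuclideanSpace ℝ (Fin n)}
    (hγ : JoinsIn g U x y γ) (hv : HasDerivWithinAt γ v (Icc 0 1) 0) :
    fderiv ℝ V x v ≤ V y - V x := by
  have hγ0 := hγ.2.2.1
  have hγ1 := hγ.2.2.2
  have hx : x ∈ U := hγ0 ▸ hγ.2.1 (by simp)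
  have hy : y ∈ U := hγ1 ▸ hγ.2.1 (by simp)
  have hd : HasDerivWithinAt (V ∘ γ) (fderiv ℝ V x v) (Icc 0 1) 0 := by
    have := hV.hasDerivWithinAt_comp hU (by rwa [hγ0]) hv
    rwa [hγ0] at this
  have hd' : HasDerivWithinAt (V ∘ γ) (fderiv ℝ V x v) (Ioi 0) 0 :=
    (hd.mono Ioc_subset_Icc_self).mono_of_mem_nhdsWithin (Ioc_mem_nhdsGT zero_lt_one)
  rw [hasDerivWithinAt_iff_tendsto_slope' (by simp)] at hd'
  -- Convexity bounds every slope `(V (γ t) - V x) / t` by `V y - V x`.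
  refine le_of_tendsto hd' ?_
  filter_upwards [Ioc_mem_nhdsGT zero_lt_one] with t ht
  have := hVg x hx y hy γ hγ t ⟨ht.1.le, ht.2⟩
  rw [slope_def_field, Function.comp_apply, Function.comp_apply, hγ0, sub_zero,
    div_le_iff₀ ht.1]
  linarith

end ExponentialMap

end GeodLyap

/-! ### The straight-line homotopy -/

theorem theorem3p2 {n : ℕ} (g : GeodLyap.Metric n) (U : Set (EuclideanSpace ℝ (Fin n)))
    (hUo : IsOpen U) (hUg : GeodLyap.IsGConvex g U)
    (F : EuclideanSpace ℝ (Fin n) → EuclideanSpace ℝ (Fin n)) (hF : ContinuousOn F U)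
    (hGAS : GeodLyap.IsGAS U F)
    (V : EuclideanSpace ℝ (Fin n) → ℝ) (hV : GeodLyap.IsLyapunov U F V)
    (hVg : GeodLyap.GConvexOn g U V) :
    ∃ X : EuclideanSpace ℝ (Fin n) → EuclideanSpace ℝ (Fin n),
      -- `X(x)` is the one and only `v` with `Exp_x(v) = 0`
      (∀ x ∈ U, ∀ v : EuclideanSpace ℝ (Fin n),
        (v ∈ GeodLyap.expDomainIn g U x ∧ GeodLyap.expMap g x v = 0) ↔ v = X x) ∧
      -- the straight-line homotopy from `F` to `X` is continuous
      ContinuousOn (fun p : ℝ × EuclideanSpace ℝ (Fin n) => (1 - p.1) • F p.2 + p.1 • X p.2)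
        (Set.Icc (0 : ℝ) 1 ×ˢ U) ∧
      -- `0` is globally asymptotically stable throughout
      ∀ s ∈ Set.Icc (0 : ℝ) 1, GeodLyap.IsGAS U (fun x => (1 - s) • F x + s • X x) := by
  have h0U := hGAS.zero_mem
  have h0 : (0 : ℝ) ∈ Icc (0 : ℝ) 1 := by simp
  have h1 : (1 : ℝ) ∈ Icc (0 : ℝ) 1 := by simp
  have hex : ∀ x ∈ U, ∃ z, GeodLyap.IsGeodesicLift g z ∧
      GeodLyap.JoinsIn g U x 0 fun t => (z t).1 := by
    intro x hx
    obtain ⟨γ, hγ, -⟩ := hUg x hx 0 h0U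
    obtain ⟨v, hv⟩ := hγ.1.exists_lift
    exact ⟨_, hv, hγ⟩
  choose! Z hZ hZj using hex
  have hZU : ∀ x ∈ U, ∀ t ∈ Icc (0 : ℝ) 1, (Z x t).1 ∈ U := fun x hx t ht => (hZj x hx).2.1 ht
  have hZ0 : ∀ x ∈ U, (Z x 0).1 = x := fun x hx => (hZj x hx).2.2.1
  have hZ1 : ∀ x ∈ U, (Z x 1).1 = 0 := fun x hx => (hZj x hx).2.2.2
  have hX : ContinuousOn (fun x => (Z x 0).2) U := by
    refine hUg.continuousOn_velocity hUo hZ hZU hZ0 hZ1 fun x hx => ?_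
    -- Since `V 0 = 0`, convexity gives `V ≤ V y` along the geodesic from `y`; the `+ 1` leaves room
    -- for `y` near `x`.
    refine ⟨U ∩ V ⁻¹' Iic (V x + 1), inter_subset_left, hV.isCompact_sublevel _, ?_⟩
    have hVx := (hV.differentiableAt hUo hx).continuousAt
    filter_upwards [hUo.mem_nhds hx, hVx.eventually_lt_const (lt_add_one (V x))] with y hy hyV t ht
    refine ⟨hZU y hy t ht, ?_⟩
    have h2 := hVg y hy 0 h0U _ (hZj y hy) t ht
    rw [hV.zero, mul_zero, add_zero] at h2
    have h3 := mul_nonneg ht.1 (hV.nonneg hy)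
    show V (Z y t).1 ≤ V x + 1
    linarith
  have hX0 : (Z 0 0).2 = 0 := by
    have hc := GeodLyap.isGeodesicLift_const g 0
    exact hUg.velocity_eq (hZj 0 h0U) (hc.joinsIn fun _ _ => h0U)
      ((hZ 0 h0U).hasDerivWithinAt_fst h0) (hc.hasDerivWithinAt_fst h0)
  refine ⟨fun x => (Z x 0).2, fun x hx v => ⟨?_, ?_⟩, ?_, fun s hs => ?_⟩
  · rintro ⟨⟨⟨γ, hγ, hγ0, hγv⟩, hvU⟩, hexp⟩
    obtain ⟨w, hw⟩ := hγ.exists_lift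
    have hw0 : w 0 = v :=
      (uniqueDiffOn_Icc zero_lt_one 0 h0).eq_deriv _ (hw.hasDerivWithinAt_fst h0) hγv
    have hval : ∀ t ∈ Icc (0 : ℝ) 1, GeodLyap.expMap g x (t • v) = γ t := fun t ht => by
      simpa only [hw0, hγ0] using (hw.smul_mem_expDomain ht).2
    refine hUg.velocity_eq ⟨hγ, fun t ht => ?_, hγ0, ?_⟩ (hZj x hx) hγv
      ((hZ x hx).hasDerivWithinAt_fst h0)
    · rw [← hval t ht]; exact hvU t ht
    · rw [← hval 1 h1, one_smul]; exact hexp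
  · rintro rfl
    have hval : ∀ t ∈ Icc (0 : ℝ) 1, t • (Z x 0).2 ∈ GeodLyap.expDomain g x ∧
        GeodLyap.expMap g x (t • (Z x 0).2) = (Z x t).1 := fun t ht => by
      simpa only [hZ0 x hx] using (hZ x hx).smul_mem_expDomain ht
    have hone := hval 1 h1
    rw [one_smul, hZ1 x hx] at hone
    refine ⟨⟨hone.1, fun t ht => ?_⟩, hone.2⟩
    rw [(hval t ht).2]
    exact hZU x hx t ht
  · have hsnd : MapsTo Prod.snd (Icc (0 : ℝ) 1 ×ˢ U) U := fun p hp => hp.2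
    exact ((continuousOn_const.sub continuousOn_fst).smul
      (hF.comp continuousOn_snd hsnd)).add (continuousOn_fst.smul
        (hX.comp continuousOn_snd hsnd))
  · have hVs : GeodLyap.IsLyapunov U (fun x => (1 - s) • F x + s • (Z x 0).2) V :=
      { smooth := hV.smooth
        zero := hV.zero
        pos := hV.pos
        decrease := fun x hx hx0 => by
          have h2 := hV.fderiv_le_of_geodesic hVg hUo (hZj x hx)
            ((hZ x hx).hasDerivWithinAt_fst h0)
          have h3 := hV.pos x hx hx0
          have h4 := hV.decrease x hx hx0
          rw [hV.zero] at h2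
          rw [map_add, map_smul, map_smul, smul_eq_mul, smul_eq_mul]
          -- At `s = 0` strictness comes from `F`; for `s > 0` it comes from `X`, and `F`
          -- contributes at most `0`.
          rcases hs.1.eq_or_lt with rfl | hs0
          · linarith
          · have h5 := mul_neg_of_pos_of_neg hs0 (show fderiv ℝ V x (Z x 0).2 < 0 by linarith)
            have h6 := mul_nonpos_of_nonneg_of_nonpos (sub_nonneg.2 hs.2) h4.le
            linarith
        proper := hV.proper }
    exact hVs.isGAS hUo h0U ((hF.const_smul (1 - s)).add (hX.const_smul s))
      (by simp [hGAS.equilibrium, hX0])
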